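/- Let $N\ge 1$ and let $J:\mathbb R^N\to\mathbb R$ be continuous, nonnegative and radially symmetric, with $\int_{\mathbb R^N} J=1$ and $\operatorname{supp} J=\overline{B}_{R_J}(0)$. Put $\Gamma(s)=\operatorname{sign}(s)(|s|-1)_+$. For $f\in L^1(\mathbb R^N)$, an $L^1$-solution of $u_t=J*\Gamma(u)-\Gamma(u)$, $u(0)=f$, is a curve $u\in C([0,\infty);L^1(\mathbb R^N))$ with $u(t)=f+\int_0^t\big(J*\Gamma(u(s))-\Gamma(u(s))\big)\,ds$ for all $t\ge0$. A solution of the nonlocal biobstacle problem (BOP) with data $f\in L^1(\mathbb R^N)$ is a $w\in L^1(\mathbb R^N)$ such that $f+J*w-w\in\beta(w)$ a.e., where $\beta$ is the graph of the sign function: $\beta(w)=\{\operatorname{sign} w\}$ for $w\ne0$ and $\beta(0)=[-1,1]$. Let $\mathcal D$ be the set of those $f\in L^1(\mathbb R^N)$ for which $f_+\le g_1$ and $f_-\le g_2$ a.e. for some $g_1,g_2\in L^1(\mathbb R^N)\cap C_0(\mathbb R^N)$ that are radial and strictly decreasing in the radial variable. For a locally integrable $g$, $\operatorname{supp}_{\mathcal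 D'}(g)$ is the complement of the largest open set on which the distribution $g$ vanishes. Distances to the empty set are $+\infty$. **Theorem.** 1. For every $f\in L^1(\mathbb R^N)$ there is exactly one $L^1$-solution. 2. $\mathcal D$ is dense in $L^1(\mathbb R^N)$, and (BOP) has exactly one solution $w\in L^1(\mathbb R^N)$ for every $f\in\mathcal D$, and for every $f\in L^1(\mathbb R^N)$ if $N\ge3$. 3. The projection $f\mapsto\tilde f:=f+J*w-w$ ($w$ the solution of (BOP) with data $f$) extends from $\mathcal D$ to all of $L^1(\mathbb R^N)$: there is an operator $\mathcal P:L^1(\mathbb R^N)\to L^1(\mathbb R^N)$ with $\|\mathcal Pf-\mathcal Pg\|_{L^1}\le\|f-g\|_{L^1}$ for all $f,g$, and $\mathcal Pf=f+J*w-w$ whenever $w\in L^1(\mathbb R^N)$ solves (BOP) with data $f$; and $\mathcal P$ is the only continuous operator on $L^1(\mathbb R^N)$ that agrees with $f\mapsto\tilde f$ on $\mathcal D$. 4. Let $f\in L^1(\mathbb R^N)$ and let $u$ be the corresponding $L^1$-solution. Assume that the positive and negative parts of the temperature never interact, that is, for every $t>0$, $$\operatorname{dist}\big(\operatorname{supp}_{\mathcal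 D'}(\Gamma(u(t))_+),\operatorname{supp}_{\mathcal D'}(\Gamma(u(t))_-)\big)\ge R_J ,$$ or that the following condition on the data holds: if $\mathbb U^\pm$ denote the $L^1$-solutions with initial data $f_\pm$, then $$\operatorname{dist}\Big(\bigcup_{t>0}\operatorname{supp}_{\mathcal D'}\big(\Gamma(\mathbb U^+(t))\big),\ \bigcup_{t>0}\operatorname{supp}_{\mathcal D'}\big(\Gamma(\mathbb U^-(t))\big)\Big)\ge R_J .$$ Then $u(t)\to\mathcal Pf$ in $L^1(\mathbb R^N)$ as $t\to\infty$. -/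

import Mathlib

open MeasureTheory Filter Topology
open scoped ContDiff

noncomputable section

namespace NonlocalStefan

/-- The Euclidean space `ℝ^N`. -/
abbrev Space (N : ℕ) : Type := EuclideanSpace ℝ (Fin N)

/-- The Banach space `L¹(ℝ^N)` of (classes of) Lebesgue integrable real functions. -/
abbrev L1 (N : ℕ) : Type := Lp ℝ 1 (volume : Measure (Space N))

/-- The convolution kernel: continuous, nonnegative, radially symmetric, of integral one, with
(compact) support the closed ball of radius `R` centred at the origin. -/
structure Kernel (N : ℕ) where
  /-- the kernel -/
  J : Space N → ℝ
  /-- the radius of the support of the kernel -/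
  R : ℝ
  continuous : Continuous J
  nonneg : ∀ x, 0 ≤ J x
  radial : ∀ x y, ‖x‖ = ‖y‖ → J x = J y
  integral_eq_one : ∫ x, J x = 1
  support_eq : tsupport J = Metric.closedBall 0 R

theorem Kernel.integrable {N : ℕ} (K : Kernel N) : Integrable K.J := by
  refine K.continuous.integrable_of_hasCompactSupport ?_
  rw [HasCompactSupport, K.support_eq]
  exact isCompact_closedBall 0 K.R

/-- The convolution `J ∗ w`, `(J ∗ w)(x) = ∫ J(y) w(x - y) dy`, of `w ∈ L¹(ℝ^N)` with the
kernel, as an element of `L¹(ℝ^N)`. -/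
def Kernel.conv {N : ℕ} (K : Kernel N) (w : L1 N) : L1 N :=
  (K.integrable.integrable_convolution (ContinuousLinearMap.mul ℝ ℝ)
    (L1.integrable_coeFn w)).toL1

/-- The graph `Γ(s) = sign(s) (|s| - 1)₊`. -/
def Gam (s : ℝ) : ℝ := Real.sign s * max (|s| - 1) 0

theorem Gam_eq (s : ℝ) : Gam s = max (s - 1) 0 - max (-s - 1) 0 := by
  unfold Gam
  rcases lt_trichotomy s 0 with h | h | h
  · rw [Real.sign_of_neg h, abs_of_neg h, max_eq_right (by linarith : s - 1 ≤ 0)]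
    ring
  · simp [h]
  · rw [Real.sign_of_pos h, abs_of_pos h, max_eq_right (by linarith : -s - 1 ≤ 0)]
    ring

theorem Gam_zero : Gam 0 = 0 := by simp [Gam]

theorem Gam_lipschitz : LipschitzWith 1 Gam := by
  refine LipschitzWith.of_dist_le_mul fun s t => ?_
  simp only [Real.dist_eq, NNReal.coe_one, one_mul, Gam_eq]
  rcases max_cases (s - 1) 0 with h1 | h1 <;> rcases max_cases (-s - 1) 0 with h2 | h2 <;>
  rcases max_cases (t - 1) 0 with h3 | h3 <;> rcases max_cases (-t - 1) 0 with h4 | h4 <;>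
  rw [h1.1, h2.1, h3.1, h4.1, abs_le] <;> constructor <;>
  linarith [le_abs_self (s - t), neg_abs_le (s - t), abs_nonneg (s - t)]

/-- The temperature `Γ(u)` of an enthalpy `u ∈ L¹(ℝ^N)`, as an element of `L¹(ℝ^N)`. -/
def temperature {N : ℕ} (u : L1 N) : L1 N := Gam_lipschitz.compLp Gam_zero u

/-- `u` is an `L¹`-solution of `u_t = J ∗ Γ(u) - Γ(u)`, `u(·, 0) = f`: a continuous curve
`[0, ∞) → L¹(ℝ^N)` that satisfies the equation integrated in time. (The integral is the Bochner
integral in `L¹(ℝ^N)` of a continuous integrand; values of `u` at negative times play no role.) -/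
structure IsSolution {N : ℕ} (K : Kernel N) (f : L1 N) (u : ℝ → L1 N) : Prop where
  continuousOn : ContinuousOn u (Set.Ici 0)
  eq_integral : ∀ t : ℝ, 0 ≤ t →
    u t = f + ∫ s in (0 : ℝ)..t, (K.conv (temperature (u s)) - temperature (u s))

/-- The maximal monotone graph `β` of the sign function: `β(w) = {sign w}` for `w ≠ 0` and
`β(0) = [-1, 1]`. -/
def signGraph (w : ℝ) : Set ℝ := {b | (w ≠ 0 → b = Real.sign w) ∧ (w = 0 → b ∈ Set.Icc (-1) 1)}

/-- `f + J ∗ w - w`, which is the projection of `f` when `w` solves the biobstacle problem. -/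
def Kernel.mesa {N : ℕ} (K : Kernel N) (f w : L1 N) : L1 N := f + K.conv w - w

/-- `w ∈ L¹(ℝ^N)` solves the nonlocal biobstacle problem with data `f`:
`f + J ∗ w - w ∈ β(w)` almost everywhere. -/
def IsBOPSolution {N : ℕ} (K : Kernel N) (f w : L1 N) : Prop :=
  ∀ᵐ x : Space N, K.mesa f w x ∈ signGraph (w x)

/-- `g ∈ L¹(ℝ^N) ∩ C₀(ℝ^N)`, radial and strictly decreasing in the radial variable. -/
structure IsBarrier {N : ℕ} (g : Space N → ℝ) : Prop where
  continuous : Continuous g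
  integrable : Integrable g
  vanishing : Tendsto g (cocompact (Space N)) (𝓝 0)
  radial : ∀ x y, ‖x‖ = ‖y‖ → g x = g y
  strictAnti : ∀ x y, ‖x‖ < ‖y‖ → g y < g x

/-- `f₊ ≤ g₁` and `f₋ ≤ g₂` almost everywhere, for some `g₁, g₂ ∈ L¹ ∩ C₀` that are radial and
strictly decreasing in the radial variable. -/
def IsDominated {N : ℕ} (f : L1 N) : Prop :=
  ∃ g₁ g₂ : Space N → ℝ, IsBarrier g₁ ∧ IsBarrier g₂ ∧
    ∀ᵐ x : Space N, max (f x) 0 ≤ g₁ x ∧ max (-f x) 0 ≤ g₂ x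

/-- The distributional support of a locally integrable function `g`: the complement of the
largest open set on which the distribution `φ ↦ ∫ g φ` vanishes. -/
def distSupport {N : ℕ} (g : Space N → ℝ) : Set (Space N) :=
  (⋃₀ {O : Set (Space N) | IsOpen O ∧ ∀ φ : Space N → ℝ, ContDiff ℝ ∞ φ → HasCompactSupport φ →
    tsupport φ ⊆ O → ∫ x, g x * φ x = 0})ᶜ

/-- The distance of two sets is at least `r` (the distance to the empty set being `+∞`). -/
def SeparatedBy {N : ℕ} (r : ℝ) (A B : Set (Space N)) : Prop :=
  ∀ x ∈ A, ∀ y ∈ B, r ≤ dist x y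

/-- The positive and the negative part of the temperature `Γ(u)` never interact: at each time
`t > 0` their distributional supports are at distance at least `R` (the radius of the support of
the kernel). -/
def NonInteracting {N : ℕ} (K : Kernel N) (u : ℝ → L1 N) : Prop :=
  ∀ t : ℝ, 0 < t → SeparatedBy K.R
    (distSupport fun x => max (temperature (u t) x) 0)
    (distSupport fun x => max (-temperature (u t) x) 0)

/-- Non-interaction in terms of the data `f` alone: the distance between the sets that are swept
by the supports of the temperatures of the solutions with data `f₊` and `f₋` (these supports are
nondecreasing in time) is at least `R`. -/
def DataNonInteracting {N : ℕ} (K : Kernel N) (f : L1 N) : Prop :=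
  ∃ Up Um : ℝ → L1 N,
    IsSolution K (Lp.posPart f) Up ∧ IsSolution K (Lp.negPart f) Um ∧
    SeparatedBy K.R
      (⋃ t ∈ Set.Ioi (0 : ℝ), distSupport (temperature (Up t)))
      (⋃ t ∈ Set.Ioi (0 : ℝ), distSupport (temperature (Um t)))

end NonlocalStefan

end

/-!
The operator `u ↦ J ∗ u` on `L¹` is positive and preserves mass, and `Γ = (I + β)⁻¹`. Everything is
derived from these two facts and from two explicit barriers.

*The biobstacle problem.* It is the fixed point equation `w = Γ(f + J ∗ w)`
(`isBOPSolution_iff`). Since `Γ` and `I - Γ` are both nondecreasing, two solutions satisfy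
`|f̃₁ - f̃₂| + |w₁ - w₂| = |f₁ - f₂ + J ∗ (w₁ - w₂)|`; taking norms, the projection `f ↦ f̃` is a
contraction (`IsBOPSolution.norm_mesa_sub_le`), and two solutions with the same data differ by some
`d` with `|d| = J ∗ |d|`. The explicit spreading profiles `p_s(x) = s^{-a} exp (-b |x|² / s)`
satisfy `J ∗ p_s ≤ p_{s+1}` (`Kernel.avg_heat_le`) and decay uniformly. Testing with them gives
`d = 0`, and their partial sums are integrable supersolutions for dominated data
(`IsDominated.exists_isControlledBy`). Between the supersolution `W` and `-W` the monotone
iteration of `w ↦ Γ(f + J ∗ w)` converges. In dimension `N ≥ 3` a bounded superharmonic function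
(`Kernel.avg_potential_le`) bounds `J ∗ v` by `‖F‖` whenever `v ≥ 0` and `v - J ∗ v ≤ F`
(`Kernel.exists_conv_le`); since `|f̃| = 1` where `w ≠ 0`, the solutions have supports of
bounded measure, so that `w` depends continuously in `L¹` on `f`, and existence passes from the
dense class to all data. The projection extends by density.

*The evolution problem.* Its field `F(u) = J ∗ Γ(u) - Γ(u)` is Lipschitz, and `u ↦ u + F(u)` is
order preserving and nonexpansive. Comparison, contraction and uniqueness are instances of one flow
invariance principle (`mem_of_hasDerivWithinAt`): a closed convex set that is mapped into itself by
`I + F` is invariant. For nonnegative data with a supersolution `W`, the time integral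
`w(t) = ∫₀ᵗ Γ(u)` is increasing and stays below `W`, so it converges and the temperature `Γ(u(t))`
tends to zero in `L¹`. Comparison with the data `|f|` and density give the same for all data
(`IsSolution.tendsto_temperature`).

*Convergence.* Without interaction, `J ∗ Γ(u) ≥ 0` in the positive phase, so that a point which has
entered the positive phase never leaves it, and similarly for the negative phase
(`IsSolution.temperature_pos_of_nonInteracting`). Hence `w(t) > 0` only where `u(t) > 1`, and
`w(t) < 0` only where `u(t) < -1`: the truncation `u(t) - Γ(u(t))` belongs to `β(w(t))`. As
`u(t) = f + J ∗ w(t) - w(t)`, this says that `w(t)` solves the biobstacle problem with data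
`f - Γ(u(t))`, that is, `u(t) - Γ(u(t)) = P(f - Γ(u(t)))` (`IsSolution.isBOPSolution_baiocchi`).
Since `Γ(u(t)) → 0` and `P` is continuous, `u(t) → P f`. The condition on the data implies the
absence of interaction by comparison (`DataNonInteracting.nonInteracting`).
-/

namespace NonlocalStefan

variable {N : ℕ}

/-! ### `L¹` as an ordered Banach space -/

instance {α : Type*} [MeasurableSpace α] {μ : Measure α} : IsOrderedModule ℝ (Lp ℝ 1 μ) := by
  refine IsOrderedModule.of_smul_nonneg fun c hc v hv => ?_
  rw [← Lp.coeFn_nonneg] at hv ⊢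
  filter_upwards [hv, Lp.coeFn_smul c v] with x hx h
  rw [h]
  exact mul_nonneg hc hx

/-- On the positive cone the `L¹` norm is the integral. -/
theorem norm_eq_integral_of_nonneg {v : L1 N} (hv : 0 ≤ v) : ‖v‖ = ∫ x, v x := by
  rw [L1.norm_eq_integral_norm]
  refine integral_congr_ae ?_
  filter_upwards [(Lp.coeFn_nonneg v).2 hv] with x hx
  exact Real.norm_of_nonneg hx

/-- The `L¹` norm is additive on the positive cone. -/
theorem norm_add_of_nonneg {v w : L1 N} (hv : 0 ≤ v) (hw : 0 ≤ w) : ‖v + w‖ = ‖v‖ + ‖w‖ := by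
  rw [norm_eq_integral_of_nonneg hv, norm_eq_integral_of_nonneg hw,
    norm_eq_integral_of_nonneg (add_nonneg hv hw),
    ← integral_add (L1.integrable_coeFn v) (L1.integrable_coeFn w)]
  exact integral_congr_ae (Lp.coeFn_add v w)

theorem norm_sub_of_le {v w : L1 N} (h : v ≤ w) : ‖w - v‖ = (∫ x, w x) - ∫ x, v x := by
  rw [norm_eq_integral_of_nonneg (sub_nonneg.2 h),
    ← integral_sub (L1.integrable_coeFn w) (L1.integrable_coeFn v)]
  exact integral_congr_ae (Lp.coeFn_sub w v)

theorem integral_mono_L1 {v w : L1 N} (h : v ≤ w) : ∫ x, v x ≤ ∫ x, w x :=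
  integral_mono_ae (L1.integrable_coeFn v) (L1.integrable_coeFn w) ((Lp.coeFn_le v w).2 h)

/-- An increasing family that is bounded above converges in `L¹`: the distance of two of its
members is the difference of their integrals. -/
theorem exists_tendsto_of_monotone_of_le {ι : Type*} [LinearOrder ι] [Nonempty ι]
    {w : ι → L1 N} (hw : Monotone w) {W : L1 N} (hW : ∀ i, w i ≤ W) :
    ∃ v, Tendsto w atTop (𝓝 v) := by
  have hmono : Monotone fun i => ∫ x, w i x := fun i j hij => integral_mono_L1 (hw hij)
  have hlim := tendsto_atTop_ciSup hmono ⟨∫ x, W x, by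
    rintro _ ⟨i, rfl⟩
    exact integral_mono_L1 (hW i)⟩
  have hdist : ∀ i j, dist (w i) (w j) = dist (∫ x, w i x) (∫ x, w j x) := by
    intro i j
    rcases le_total i j with h | h
    · rw [dist_comm, dist_eq_norm, norm_sub_of_le (hw h), dist_comm, Real.dist_eq,
        abs_of_nonneg (sub_nonneg.2 (hmono h))]
    · rw [dist_eq_norm, norm_sub_of_le (hw h), Real.dist_eq,
        abs_of_nonneg (sub_nonneg.2 (hmono h))]
  refine cauchySeq_tendsto_of_complete (Metric.cauchySeq_iff.2 fun ε hε => ?_)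
  simpa only [hdist] using Metric.cauchySeq_iff.1 hlim.cauchySeq ε hε

theorem coeFn_le_of_ae {v w : L1 N} (h : ∀ᵐ x, v x ≤ w x) : v ≤ w := (Lp.coeFn_le v w).1 h

theorem ae_le_of_le {v w : L1 N} (h : v ≤ w) : ∀ᵐ x, v x ≤ w x := (Lp.coeFn_le v w).2 h

/-! ### The convolution operator -/

namespace Kernel

variable (K : Kernel N)

theorem hasCompactSupport : HasCompactSupport K.J := by
  rw [HasCompactSupport, K.support_eq]
  exact isCompact_closedBall 0 K.R

theorem even (x : Space N) : K.J (-x) = K.J x := K.radial _ _ (norm_neg x)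

theorem exists_bound : ∃ C, 0 < C ∧ ∀ x, K.J x ≤ C := by
  obtain ⟨C, hC⟩ := K.continuous.bounded_above_of_compact_support K.hasCompactSupport
  exact ⟨max C 1, by positivity, fun x =>
    (Real.le_norm_self _).trans ((hC x).trans (le_max_left _ _))⟩

/-- The pointwise convolution `(J ∗ φ)(x) = ∫ J(y) φ(x - y) dy`. -/
noncomputable def avg (φ : Space N → ℝ) (x : Space N) : ℝ := ∫ y, K.J y * φ (x - y)

theorem integrable_avg {φ : Space N → ℝ} (hφ : LocallyIntegrable φ) (x : Space N) :
    Integrable fun y => K.J y * φ (x - y) :=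
  K.hasCompactSupport.convolutionExists_left (ContinuousLinearMap.mul ℝ ℝ) K.continuous hφ x

theorem avg_congr {φ ψ : Space N → ℝ} (h : φ =ᵐ[volume] ψ) : K.avg φ = K.avg ψ :=
  convolution_congr (ContinuousLinearMap.mul ℝ ℝ) (ae_eq_refl K.J) h

theorem coeFn_conv (w : L1 N) : K.conv w =ᵐ[volume] K.avg w :=
  Integrable.coeFn_toL1 _

theorem avg_add {φ ψ : Space N → ℝ} (hφ : LocallyIntegrable φ) (hψ : LocallyIntegrable ψ)
    (x : Space N) : K.avg (fun y => φ y + ψ y) x = K.avg φ x + K.avg ψ x := by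
  simp only [avg, mul_add]
  exact integral_add (K.integrable_avg hφ x) (K.integrable_avg hψ x)

theorem avg_const_mul (c : ℝ) (φ : Space N → ℝ) (x : Space N) :
    K.avg (fun y => c * φ y) x = c * K.avg φ x := by
  simp only [avg, mul_left_comm _ c]
  exact integral_const_mul _ _

theorem avg_eq (φ : Space N → ℝ) (x : Space N) : K.avg φ x = ∫ y, K.J (x - y) * φ y :=
  convolution_eq_swap (ContinuousLinearMap.mul ℝ ℝ)

theorem conv_nonneg {w : L1 N} (hw : 0 ≤ w) : 0 ≤ K.conv w := by
  rw [← Lp.coeFn_nonneg] at hw ⊢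
  filter_upwards [K.coeFn_conv w] with x hx
  rw [hx, avg_eq]
  refine integral_nonneg_of_ae ?_
  filter_upwards [hw] with y hy
  exact mul_nonneg (K.nonneg _) hy

theorem conv_add (v w : L1 N) : K.conv (v + w) = K.conv v + K.conv w := by
  refine Lp.ext ?_
  filter_upwards [K.coeFn_conv (v + w), K.coeFn_conv v, K.coeFn_conv w,
    Lp.coeFn_add (K.conv v) (K.conv w)] with x h1 h2 h3 h4
  rw [h1, h4, Pi.add_apply, h2, h3, K.avg_congr (Lp.coeFn_add v w)]
  exact K.avg_add (L1.integrable_coeFn v).locallyIntegrable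
    (L1.integrable_coeFn w).locallyIntegrable x

theorem conv_smul (c : ℝ) (w : L1 N) : K.conv (c • w) = c • K.conv w := by
  refine Lp.ext ?_
  filter_upwards [K.coeFn_conv (c • w), K.coeFn_conv w,
    Lp.coeFn_smul c (K.conv w)] with x h1 h2 h4
  rw [h1, h4, Pi.smul_apply, h2, K.avg_congr (Lp.coeFn_smul c w)]
  exact K.avg_const_mul c w x

theorem integral_conv (w : L1 N) : ∫ x, K.conv w x = ∫ x, w x := by
  rw [integral_congr_ae (K.coeFn_conv w)]
  have := integral_convolution (ContinuousLinearMap.mul ℝ ℝ) K.integrable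
    (L1.integrable_coeFn w) (μ := volume)
  rw [K.integral_eq_one] at this
  simp only [ContinuousLinearMap.mul_apply', one_mul] at this
  exact this

theorem norm_conv_of_nonneg {w : L1 N} (hw : 0 ≤ w) : ‖K.conv w‖ = ‖w‖ := by
  rw [norm_eq_integral_of_nonneg hw, norm_eq_integral_of_nonneg (K.conv_nonneg hw),
    integral_conv]

/-- The convolution with the kernel as a linear map on `L¹`. -/
noncomputable def convₗ : L1 N →ₗ[ℝ] L1 N where
  toFun := K.conv
  map_add' := K.conv_add
  map_smul' := K.conv_smul

theorem conv_sub (v w : L1 N) : K.conv (v - w) = K.conv v - K.conv w := K.convₗ.map_sub v w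

theorem conv_neg (w : L1 N) : K.conv (-w) = -K.conv w := K.convₗ.map_neg w

theorem conv_mono {v w : L1 N} (h : v ≤ w) : K.conv v ≤ K.conv w := by
  rw [← sub_nonneg, ← conv_sub]
  exact K.conv_nonneg (sub_nonneg.2 h)

theorem abs_conv_le (w : L1 N) : |K.conv w| ≤ K.conv |w| :=
  abs_le'.2 ⟨K.conv_mono (le_abs_self w), by
    rw [← conv_neg]
    exact K.conv_mono (neg_le_abs w)⟩

theorem norm_conv_le (w : L1 N) : ‖K.conv w‖ ≤ ‖w‖ := by
  calc ‖K.conv w‖ ≤ ‖K.conv |w|‖ := norm_le_norm_of_abs_le_abs (by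
        rw [abs_of_nonneg (K.conv_nonneg (abs_nonneg w))]
        exact K.abs_conv_le w)
    _ = ‖w‖ := by rw [K.norm_conv_of_nonneg (abs_nonneg w), norm_abs_eq_norm]

/-- The convolution with the kernel as a bounded operator on `L¹`. -/
noncomputable def convL : L1 N →L[ℝ] L1 N :=
  K.convₗ.mkContinuous 1 fun w => by
    rw [one_mul]
    exact K.norm_conv_le w

@[simp] theorem convL_apply (w : L1 N) : K.convL w = K.conv w := rfl

theorem continuous_conv : Continuous K.conv := K.convL.continuous

/-- Symmetry of the convolution: `∫ (J ∗ v) φ = ∫ v (J ∗ φ)`. -/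
theorem integral_conv_mul (v : L1 N) {φ : Space N → ℝ} (hφ : Continuous φ) {C : ℝ}
    (hC : ∀ x, |φ x| ≤ C) : ∫ x, K.conv v x * φ x = ∫ x, v x * K.avg φ x := by
  have hint : Integrable (fun p : Space N × Space N => K.J p.2 * v (p.1 - p.2) * φ p.1)
      (volume.prod volume) := by
    refine Integrable.mul_bdd (c := C) ?_ (hφ.comp continuous_fst).aestronglyMeasurable
      (Eventually.of_forall fun p => hC p.1)
    exact Integrable.convolution_integrand (ContinuousLinearMap.mul ℝ ℝ) K.integrable
      (L1.integrable_coeFn v)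
  calc ∫ x, K.conv v x * φ x = ∫ x, ∫ y, K.J y * v (x - y) * φ x := by
        refine integral_congr_ae ?_
        filter_upwards [K.coeFn_conv v] with x hx
        rw [hx, integral_mul_const]
        rfl
    _ = ∫ y, ∫ x, K.J y * v (x - y) * φ x := integral_integral_swap hint
    _ = ∫ y, ∫ x, K.J (-y) * v x * φ (x - -y) := by
        refine integral_congr_ae (Eventually.of_forall fun y => ?_)
        simp only
        rw [← integral_add_right_eq_self _ y]
        simp [K.even]
    _ = ∫ y, ∫ x, K.J y * v x * φ (x - y) :=
        integral_neg_eq_self (fun y => ∫ x, K.J y * v x * φ (x - y)) volume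
    _ = ∫ x, ∫ y, K.J y * v x * φ (x - y) := by
        refine integral_integral_swap ?_
        have h1 : Integrable (fun p : Space N × Space N => K.J p.1 * v p.2)
          (volume.prod volume) := K.integrable.mul_prod (L1.integrable_coeFn v)
        refine Integrable.mul_bdd (c := C) h1 ?_ (Eventually.of_forall fun p => hC _)
        exact (hφ.comp (continuous_snd.sub continuous_fst)).aestronglyMeasurable
    _ = ∫ x, v x * K.avg φ x := by
        refine integral_congr_ae (Eventually.of_forall fun x => ?_)
        simp only [avg]
        rw [← integral_const_mul]
        congr 1
        ext y
        ring

end Kernel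

/-! ### The graph `Γ` and the temperature -/

theorem Gam_of_one_le {s : ℝ} (h : 1 ≤ s) : Gam s = s - 1 := by
  rw [Gam_eq, max_eq_left (by linarith), max_eq_right (by linarith), sub_zero]

theorem Gam_of_le_neg_one {s : ℝ} (h : s ≤ -1) : Gam s = s + 1 := by
  rw [Gam_eq, max_eq_right (by linarith), max_eq_left (by linarith)]
  ring

theorem Gam_of_abs_le_one {s : ℝ} (h₁ : -1 ≤ s) (h₂ : s ≤ 1) : Gam s = 0 := by
  rw [Gam_eq, max_eq_right (by linarith), max_eq_right (by linarith), sub_zero]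

theorem Gam_mono : Monotone Gam := by
  intro s t h
  rw [Gam_eq, Gam_eq]
  exact sub_le_sub (max_le_max (by linarith) le_rfl) (max_le_max (by linarith) le_rfl)

theorem Gam_neg (s : ℝ) : Gam (-s) = -Gam s := by
  rw [Gam_eq, Gam_eq, neg_neg, neg_sub]

/-- `s - Γ(s)` is the truncation of `s` to `[-1, 1]`; like `Γ`, it is nondecreasing. -/
theorem sub_Gam_mono : Monotone fun s => s - Gam s := by
  intro s t h
  have := Gam_lipschitz.dist_le_mul s t
  rw [Real.dist_eq, Real.dist_eq, NNReal.coe_one, one_mul, abs_sub_comm, abs_sub_comm s,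
    abs_of_nonneg (sub_nonneg.2 (Gam_mono h)), abs_of_nonneg (sub_nonneg.2 h)] at this
  change s - Gam s ≤ t - Gam t
  linarith

theorem one_lt_of_Gam_pos {s : ℝ} (h : 0 < Gam s) : 1 < s := by
  by_contra! hs
  have := Gam_mono hs
  rw [Gam_of_one_le le_rfl] at this
  linarith

theorem Gam_pos {s : ℝ} (h : 1 < s) : 0 < Gam s := by
  rw [Gam_of_one_le h.le]
  linarith

theorem Gam_nonneg {s : ℝ} (h : 0 ≤ s) : 0 ≤ Gam s := Gam_zero ▸ Gam_mono h

theorem Gam_nonpos {s : ℝ} (h : s ≤ 1) : Gam s ≤ 0 := by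
  simpa [Gam_of_one_le le_rfl] using Gam_mono h

theorem sub_Gam_le_one (s : ℝ) : s - Gam s ≤ 1 := by
  rcases le_total 1 s with h | h
  · rw [Gam_of_one_le h]
    linarith
  · calc s - Gam s ≤ 1 - Gam 1 := sub_Gam_mono h
      _ = 1 := by rw [Gam_of_one_le le_rfl]; ring

theorem neg_one_le_sub_Gam (s : ℝ) : -1 ≤ s - Gam s := by
  have := sub_Gam_le_one (-s)
  rw [Gam_neg] at this
  linarith

/-- `Γ` is the resolvent `(I + β)⁻¹` of the graph of the sign function. -/
theorem sub_mem_signGraph_iff (z w : ℝ) : z - w ∈ signGraph w ↔ w = Gam z := by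
  simp only [signGraph, Set.mem_ofPred_eq]
  constructor
  · rintro ⟨h1, h2⟩
    rcases lt_trichotomy w 0 with hw | hw | hw
    · have := h1 hw.ne
      rw [Real.sign_of_neg hw] at this
      rw [Gam_of_le_neg_one (by linarith)]
      linarith
    · have := h2 hw
      rw [Set.mem_Icc] at this
      rw [Gam_of_abs_le_one (by linarith) (by linarith), hw]
    · have := h1 hw.ne'
      rw [Real.sign_of_pos hw] at this
      rw [Gam_of_one_le (by linarith)]
      linarith
  · rintro rfl
    refine ⟨fun h => ?_, fun _ => ⟨neg_one_le_sub_Gam z, sub_Gam_le_one z⟩⟩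
    rcases le_total 1 z with h1 | h1
    · have h2 : 0 < Gam z := lt_of_le_of_ne (Gam_nonneg (by linarith)) (Ne.symm h)
      rw [Real.sign_of_pos h2, Gam_of_one_le h1]
      ring
    · rcases le_total z (-1) with h2 | h2
      · have h3 : Gam z < 0 := lt_of_le_of_ne (Gam_nonpos h1) h
        rw [Real.sign_of_neg h3, Gam_of_le_neg_one h2]
        ring
      · exact absurd (Gam_of_abs_le_one h2 h1) h

theorem abs_Gam_sub_add (s t : ℝ) :
    |Gam s - Gam t| + |(s - Gam s) - (t - Gam t)| = |s - t| := by
  rcases le_total s t with h | h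
  · have h1 := Gam_mono h
    have h2 : s - Gam s ≤ t - Gam t := sub_Gam_mono h
    rw [abs_of_nonpos (by linarith), abs_of_nonpos (by linarith), abs_of_nonpos (by linarith)]
    ring
  · have h1 := Gam_mono h
    have h2 : t - Gam t ≤ s - Gam s := sub_Gam_mono h
    rw [abs_of_nonneg (by linarith), abs_of_nonneg (by linarith), abs_of_nonneg (by linarith)]
    ring

theorem coeFn_temperature (u : L1 N) : temperature u =ᵐ[volume] fun x => Gam (u x) :=
  Gam_lipschitz.coeFn_compLp Gam_zero u

theorem temperature_lipschitz : LipschitzWith 1 (temperature : L1 N → L1 N) :=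
  Gam_lipschitz.lipschitzWith_compLp Gam_zero

theorem temperature_zero : temperature (0 : L1 N) = 0 :=
  Gam_lipschitz.compLp_zero Gam_zero

theorem temperature_mono : Monotone (temperature : L1 N → L1 N) := by
  intro u v h
  refine coeFn_le_of_ae ?_
  filter_upwards [coeFn_temperature u, coeFn_temperature v, ae_le_of_le h] with x h1 h2 h3
  rw [h1, h2]
  exact Gam_mono h3

theorem temperature_nonneg {u : L1 N} (h : 0 ≤ u) : 0 ≤ temperature u :=
  temperature_zero (N := N) ▸ temperature_mono h

theorem temperature_neg (u : L1 N) : temperature (-u) = -temperature u := by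
  refine Lp.ext ?_
  filter_upwards [coeFn_temperature u, coeFn_temperature (-u), Lp.coeFn_neg u,
    Lp.coeFn_neg (temperature u)] with x h1 h2 h3 h4
  rw [h2, h3, h4, Pi.neg_apply, Pi.neg_apply, h1, Gam_neg]

theorem sub_temperature_mono : Monotone fun u : L1 N => u - temperature u := by
  intro u v h
  refine coeFn_le_of_ae ?_
  filter_upwards [coeFn_temperature u, coeFn_temperature v, ae_le_of_le h,
    Lp.coeFn_sub u (temperature u), Lp.coeFn_sub v (temperature v)] with x h1 h2 h3 h4 h5
  rw [h4, h5, Pi.sub_apply, Pi.sub_apply, h1, h2]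
  exact sub_Gam_mono h3

theorem norm_temperature_le (u : L1 N) : ‖temperature u‖ ≤ ‖u‖ := by
  simpa [temperature_zero] using temperature_lipschitz.norm_sub_le u 0

theorem abs_temperature_sub_add (u v : L1 N) :
    |temperature u - temperature v| + |(u - temperature u) - (v - temperature v)| = |u - v| := by
  refine Lp.ext ?_
  filter_upwards [coeFn_temperature u, coeFn_temperature v,
    Lp.coeFn_sub u (temperature u), Lp.coeFn_sub v (temperature v),
    Lp.coeFn_sub (temperature u) (temperature v), Lp.coeFn_sub u v,
    Lp.coeFn_sub (u - temperature u) (v - temperature v),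
    Lp.coeFn_abs (temperature u - temperature v),
    Lp.coeFn_abs ((u - temperature u) - (v - temperature v)), Lp.coeFn_abs (u - v),
    Lp.coeFn_add |temperature u - temperature v| |(u - temperature u) - (v - temperature v)|]
    with x h1 h2 h3 h4 h5 h6 h7 h8 h9 h10 h11
  rw [h11, Pi.add_apply, h8, h9, h10, h7, Pi.sub_apply, h3, h4, h5, h6, Pi.sub_apply,
    Pi.sub_apply, Pi.sub_apply, Pi.sub_apply, h1, h2]
  exact abs_Gam_sub_add _ _

/-- The temperature and the truncation `u - Γ(u)` split an `L¹` distance. -/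
theorem norm_temperature_sub_add (u v : L1 N) :
    ‖temperature u - temperature v‖ + ‖(u - temperature u) - (v - temperature v)‖ =
      ‖u - v‖ := by
  rw [← norm_abs_eq_norm (temperature u - temperature v), ← norm_abs_eq_norm (u - v),
    ← norm_abs_eq_norm (u - temperature u - (v - temperature v)),
    ← norm_add_of_nonneg (abs_nonneg _) (abs_nonneg _), abs_temperature_sub_add]

/-! ### The biobstacle problem as a fixed point equation -/

/-- The biobstacle problem is the fixed point equation `w = Γ(f + J ∗ w)`. -/
theorem isBOPSolution_iff (K : Kernel N) (f w : L1 N) :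
    IsBOPSolution K f w ↔ w = temperature (f + K.conv w) := by
  have h : ∀ᵐ x, (K.mesa f w x ∈ signGraph (w x) ↔ w x = temperature (f + K.conv w) x) := by
    filter_upwards [coeFn_temperature (f + K.conv w), Lp.coeFn_sub (f + K.conv w) w]
      with x h1 h2
    rw [h1, Kernel.mesa, h2, Pi.sub_apply]
    exact sub_mem_signGraph_iff _ _
  constructor
  · intro hw
    refine Lp.ext ?_
    filter_upwards [h, hw] with x h1 h2 using h1.1 h2
  · intro hw
    filter_upwards [h] with x h1
    exact h1.2 (by rw [← hw])

theorem IsBOPSolution.temperature_eq {K : Kernel N} {f w : L1 N} (h : IsBOPSolution K f w) :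
    temperature (f + K.conv w) = w := ((isBOPSolution_iff K f w).1 h).symm

/-- Two solutions of the biobstacle problem: the order of `w` and of the projection agree, so that
`|f̃₁ - f̃₂| + |w₁ - w₂| = |f₁ - f₂ + J ∗ (w₁ - w₂)|`. -/
theorem IsBOPSolution.norm_mesa_sub_add {K : Kernel N} {f₁ w₁ f₂ w₂ : L1 N}
    (h₁ : IsBOPSolution K f₁ w₁) (h₂ : IsBOPSolution K f₂ w₂) :
    ‖w₁ - w₂‖ + ‖K.mesa f₁ w₁ - K.mesa f₂ w₂‖ = ‖f₁ - f₂ + K.conv (w₁ - w₂)‖ := by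
  have := norm_temperature_sub_add (f₁ + K.conv w₁) (f₂ + K.conv w₂)
  rw [h₁.temperature_eq, h₂.temperature_eq] at this
  rw [Kernel.mesa, Kernel.mesa, this, K.conv_sub]
  congr 1
  abel

/-- The projection is an `L¹` contraction. -/
theorem IsBOPSolution.norm_mesa_sub_le {K : Kernel N} {f₁ w₁ f₂ w₂ : L1 N}
    (h₁ : IsBOPSolution K f₁ w₁) (h₂ : IsBOPSolution K f₂ w₂) :
    ‖K.mesa f₁ w₁ - K.mesa f₂ w₂‖ ≤ ‖f₁ - f₂‖ := by
  have h3 := h₁.norm_mesa_sub_add h₂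
  have h4 := norm_add_le (f₁ - f₂) (K.conv (w₁ - w₂))
  have h5 := K.norm_conv_le (w₁ - w₂)
  linarith

theorem isBOPSolution_zero (K : Kernel N) : IsBOPSolution K 0 0 := by
  rw [isBOPSolution_iff, ← K.convL_apply, map_zero, add_zero, temperature_zero]

/-- Two solutions with the same data differ by a `d` with `|d| = J ∗ |d|`. -/
theorem IsBOPSolution.abs_sub_eq {K : Kernel N} {f w₁ w₂ : L1 N}
    (h₁ : IsBOPSolution K f w₁) (h₂ : IsBOPSolution K f w₂) :
    K.conv |w₁ - w₂| = |w₁ - w₂| := by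
  have h : |w₁ - w₂| ≤ K.conv |w₁ - w₂| := by
    have := abs_temperature_sub_add (f + K.conv w₁) (f + K.conv w₂)
    rw [h₁.temperature_eq, h₂.temperature_eq, add_sub_add_left_eq_sub, ← K.conv_sub] at this
    calc |w₁ - w₂| ≤ _ := le_add_of_nonneg_right (abs_nonneg _)
      _ = |K.conv (w₁ - w₂)| := this
      _ ≤ K.conv |w₁ - w₂| := K.abs_conv_le _
  have hn := norm_sub_of_le h
  rw [K.integral_conv, sub_self, norm_eq_zero, sub_eq_zero] at hn
  exact hn

/-! ### Data with an integrable supersolution -/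

/-- `f` is controlled by `W`: `W ≥ 0` is a supersolution of the biobstacle problem for the
data `|f|`, that is, `|f| + J ∗ W - W ≤ 1`. -/
structure IsControlledBy (K : Kernel N) (f W : L1 N) : Prop where
  nonneg : 0 ≤ W
  le_one : ∀ᵐ x, |f x| + K.conv W x - W x ≤ 1

theorem IsControlledBy.abs {K : Kernel N} {f W : L1 N} (h : IsControlledBy K f W) :
    IsControlledBy K |f| W := by
  refine ⟨h.nonneg, ?_⟩
  filter_upwards [h.le_one, Lp.coeFn_abs f] with x h1 h2
  rwa [h2, abs_abs]

theorem IsControlledBy.neg {K : Kernel N} {f W : L1 N} (h : IsControlledBy K f W) :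
    IsControlledBy K (-f) W := by
  refine ⟨h.nonneg, ?_⟩
  filter_upwards [h.le_one, Lp.coeFn_neg f] with x h1 h2
  rwa [h2, Pi.neg_apply, abs_neg]

theorem IsControlledBy.temperature_le {K : Kernel N} {f W : L1 N} (h : IsControlledBy K f W) :
    temperature (f + K.conv W) ≤ W := by
  refine coeFn_le_of_ae ?_
  filter_upwards [h.le_one, (Lp.coeFn_nonneg W).2 h.nonneg, coeFn_temperature (f + K.conv W),
    Lp.coeFn_add f (K.conv W)] with x h1 h2 h3 h4
  have h2 : 0 ≤ W x := h2
  rw [h3, h4, Pi.add_apply]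
  have h5 : f x + K.conv W x ≤ W x + 1 := by linarith [le_abs_self (f x)]
  calc _ ≤ Gam (W x + 1) := Gam_mono h5
    _ = W x := by rw [Gam_of_one_le (by linarith)]; ring

/-- The monotone iteration `w ↦ Γ(f + J ∗ w)` between the barriers `-W` and `W` solves the
biobstacle problem. -/
theorem IsControlledBy.exists_isBOPSolution {K : Kernel N} {f W : L1 N}
    (h : IsControlledBy K f W) : ∃ w, IsBOPSolution K f w := by
  set S : L1 N → L1 N := fun w => temperature (f + K.conv w) with hS
  have hSmono : Monotone S := fun v w hvw =>
    temperature_mono (add_le_add_right (K.conv_mono hvw) f)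
  have hScont : Continuous S :=
    temperature_lipschitz.continuous.comp (continuous_const.add K.continuous_conv)
  have hup : S W ≤ W := h.temperature_le
  have hlow : -W ≤ S (-W) := by
    have h1 := h.neg.temperature_le
    have h2 : -f + K.conv W = -(f + K.conv (-W)) := by
      rw [K.conv_neg]
      abel
    rw [h2, temperature_neg] at h1
    exact neg_le.1 h1
  have hW : -W ≤ W := (neg_nonpos.2 h.nonneg).trans h.nonneg
  have hle : ∀ n, S^[n] (-W) ≤ W := by
    intro n
    induction n with
    | zero => exact hW
    | succ n ih =>
      rw [Function.iterate_succ_apply']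
      exact (hSmono ih).trans hup
  obtain ⟨w, hw⟩ := exists_tendsto_of_monotone_of_le
    (hSmono.monotone_iterate_of_le_map hlow) hle
  refine ⟨w, (isBOPSolution_iff K f w).2 ?_⟩
  exact (isFixedPt_of_tendsto_iterate hw hScont.continuousAt).symm

/-! ### Explicit supersolutions for the nonlocal heat equation -/

namespace Kernel

variable (K : Kernel N)

theorem apply_eq_zero_of_lt {x : Space N} (h : K.R < ‖x‖) : K.J x = 0 := by
  refine image_eq_zero_of_notMem_tsupport ?_
  rw [K.support_eq, mem_closedBall_zero_iff]
  exact not_le.2 h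

theorem integrable_mul_continuous {φ : Space N → ℝ} (hφ : Continuous φ) :
    Integrable fun y => K.J y * φ y :=
  (K.continuous.mul hφ).integrable_of_hasCompactSupport K.hasCompactSupport.mul_right

/-- The second moment `∫ J(y) |y|² dy` of the kernel. -/
noncomputable def moment : ℝ := ∫ y, K.J y * ‖y‖ ^ 2

/-- For `N ≥ 1` the kernel, a density, is not concentrated at the origin. -/
theorem exists_ne_zero (hN : 1 ≤ N) : ∃ y, y ≠ 0 ∧ K.J y ≠ 0 := by
  by_contra! h
  have : Nonempty (Fin N) := ⟨⟨0, hN⟩⟩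
  have h1 : K.J =ᵐ[volume] 0 := by
    filter_upwards [Measure.ae_ne volume (0 : Space N)] with y hy using h y hy
  have h2 := integral_congr_ae h1
  rw [K.integral_eq_one] at h2
  simp at h2

theorem radius_pos (hN : 1 ≤ N) : 0 < K.R := by
  obtain ⟨y, hy, hJ⟩ := K.exists_ne_zero hN
  by_contra! h
  exact hJ (K.apply_eq_zero_of_lt (h.trans_lt (norm_pos_iff.2 hy)))

theorem moment_pos (hN : 1 ≤ N) : 0 < K.moment := by
  obtain ⟨y, hy, hJ⟩ := K.exists_ne_zero hN
  refine (K.continuous.mul (by fun_prop)).integral_pos_of_hasCompactSupport_nonneg_nonzero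
    K.hasCompactSupport.mul_right (fun z => mul_nonneg (K.nonneg z) (by positivity)) (x := y) ?_
  exact mul_ne_zero hJ (pow_ne_zero 2 (norm_ne_zero_iff.2 hy))

/-- The kernel also vanishes on the sphere that bounds its support. -/
theorem apply_eq_zero_of_le (hN : 1 ≤ N) {x : Space N} (h : K.R ≤ ‖x‖) : K.J x = 0 := by
  have hx : 0 < ‖x‖ := (K.radius_pos hN).trans_le h
  have h1 : Tendsto (fun c : ℝ => K.J (c • x)) (𝓝[>] 1) (𝓝 (K.J ((1 : ℝ) • x))) :=
    ((K.continuous.comp (by fun_prop)).tendsto (1 : ℝ)).mono_left nhdsWithin_le_nhds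
  rw [one_smul] at h1
  refine tendsto_nhds_unique h1 (tendsto_const_nhds.congr' ?_)
  filter_upwards [self_mem_nhdsWithin] with c hc
  have hc : 1 < c := hc
  refine (K.apply_eq_zero_of_lt ?_).symm
  rw [norm_smul, Real.norm_of_nonneg (by linarith)]
  nlinarith

theorem avg_eq_add (φ : Space N → ℝ) (x : Space N) : K.avg φ x = ∫ y, K.J y * φ (x + y) := by
  rw [avg, ← integral_neg_eq_self]
  simp [K.even]

/-- Symmetrization, by which terms that are odd in `y` drop out, and pointwise estimate of an
average. -/
theorem avg_le_of_symm_le {φ ψ : Space N → ℝ} (hφ : Continuous φ) (hψ : Continuous ψ)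
    {x : Space N} (h : ∀ y, ‖y‖ ≤ K.R → (φ (x - y) + φ (x + y)) / 2 ≤ ψ y) :
    K.avg φ x ≤ ∫ y, K.J y * ψ y := by
  have h1 : Integrable fun y => K.J y * φ (x - y) := K.integrable_mul_continuous (by fun_prop)
  have h2 : Integrable fun y => K.J y * φ (x + y) := K.integrable_mul_continuous (by fun_prop)
  have h3 : K.avg φ x = ∫ y, K.J y * ((φ (x - y) + φ (x + y)) / 2) := by
    have h4 : K.avg φ x = (K.avg φ x + K.avg φ x) / 2 := by ring
    rw [h4]
    nth_rw 2 [K.avg_eq_add]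
    rw [avg, ← integral_add h1 h2, ← integral_div]
    congr 1
    ext y
    ring
  rw [h3]
  refine integral_mono (K.integrable_mul_continuous (by fun_prop))
    (K.integrable_mul_continuous hψ) fun y => ?_
  rcases le_or_gt ‖y‖ K.R with hy | hy
  · exact mul_le_mul_of_nonneg_left (h y hy) (K.nonneg y)
  · simp [K.apply_eq_zero_of_lt hy]

end Kernel

theorem exp_neg_le_one_sub_half {t : ℝ} (h0 : 0 ≤ t) (h1 : t ≤ 1) :
    Real.exp (-t) ≤ 1 - t / 2 := by
  rw [Real.exp_neg, inv_le_comm₀ (Real.exp_pos t) (by linarith)]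
  refine le_trans ?_ (Real.add_one_le_exp t)
  rw [inv_le_iff_one_le_mul₀ (by linarith)]
  nlinarith

/-- The barrier `p_s(x) = s^{-a} exp (-b |x|² / s)` with `b = 1 / (4 R²)` and `a = b σ / 2`, where
`σ` is the second moment of the kernel. -/
noncomputable def Kernel.heat (K : Kernel N) (s : ℝ) (x : Space N) : ℝ :=
  s ^ (-((4 * K.R ^ 2)⁻¹ * K.moment / 2)) * Real.exp (-((4 * K.R ^ 2)⁻¹ * ‖x‖ ^ 2 / s))

namespace Kernel

variable (K : Kernel N)

theorem heat_pos {s : ℝ} (hs : 0 < s) (x : Space N) : 0 < K.heat s x :=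
  mul_pos (Real.rpow_pos_of_pos hs _) (Real.exp_pos _)

theorem heat_continuous (s : ℝ) : Continuous (K.heat s) := by
  unfold heat
  fun_prop

theorem heat_le {s : ℝ} (hs : 0 < s) (x : Space N) :
    K.heat s x ≤ s ^ (-((4 * K.R ^ 2)⁻¹ * K.moment / 2)) := by
  refine mul_le_of_le_one_right (Real.rpow_nonneg hs.le _) (Real.exp_le_one_iff.2 ?_)
  exact neg_nonpos.2 (by positivity)

theorem heat_integrable (hN : 1 ≤ N) {s : ℝ} (hs : 0 < s) : Integrable (K.heat s) := by
  have hR := K.radius_pos hN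
  refine Integrable.const_mul ?_ _
  have h := GaussianFourier.integrable_cexp_neg_mul_sq_norm_add (V := Space N)
    (b := (((4 * K.R ^ 2)⁻¹ / s : ℝ) : ℂ))
    (by rw [Complex.ofReal_re]; positivity) 0 0
  have h2 := h.re
  refine h2.congr (Eventually.of_forall fun x => ?_)
  have h3 : -(((4 * K.R ^ 2)⁻¹ / s : ℝ) : ℂ) * (‖x‖ : ℂ) ^ 2 + 0 * ((inner ℝ 0 x : ℝ) : ℂ) =
      ((-((4 * K.R ^ 2)⁻¹ * ‖x‖ ^ 2 / s) : ℝ) : ℂ) := by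
    push_cast
    ring
  simp only
  rw [h3, ← Complex.ofReal_exp]
  exact Complex.ofReal_re _

/-- The barriers form a supersolution in discrete time: `J ∗ p_s ≤ p_{s+1}`. The evenness of `J`
turns the cross term of `|x - y|²` into a hyperbolic cosine, and `cosh t ≤ exp (t² / 2)`. -/
theorem avg_heat_le (hN : 1 ≤ N) {s : ℝ} (hs : 1 ≤ s) (x : Space N) :
    K.avg (K.heat s) x ≤ K.heat (s + 1) x := by
  have hR := K.radius_pos hN
  have hs0 : 0 < s := by linarith
  set b := (4 * K.R ^ 2)⁻¹ with hb
  have hb0 : 0 < b := by positivity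
  have hbR : b * K.R ^ 2 = 1 / 4 := by
    rw [hb]
    field_simp
  set a := b * K.moment / 2 with ha
  set A := s ^ (-a) * Real.exp (-(b * ‖x‖ ^ 2 / (s + 1))) with hA
  have hpt : ∀ y, ‖y‖ ≤ K.R → (K.heat s (x - y) + K.heat s (x + y)) / 2 ≤
      A - A * b / (2 * s) * ‖y‖ ^ 2 := by
    intro y hy
    have hy2 : ‖y‖ ^ 2 ≤ K.R ^ 2 := by gcongr
    set c : ℝ := inner ℝ x y with hc
    have hc2 : c ^ 2 ≤ ‖x‖ ^ 2 * K.R ^ 2 := by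
      rw [← mul_pow]
      have := abs_real_inner_le_norm x y
      have h2 : |c| ≤ ‖x‖ * K.R := this.trans (by gcongr)
      rw [← sq_abs]
      gcongr
    have e1 : (K.heat s (x - y) + K.heat s (x + y)) / 2 = s ^ (-a) *
        (Real.exp (-(b * (‖x‖ ^ 2 + ‖y‖ ^ 2) / s)) * Real.cosh (2 * b * c / s)) := by
      rw [Kernel.heat, Kernel.heat, norm_sub_sq_real, norm_add_sq_real, ← hb, ← ha, ← hc,
        Real.cosh_eq, mul_div_assoc', mul_add (Real.exp _), ← Real.exp_add, ← Real.exp_add,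
        ← mul_add, mul_div_assoc']
      congr 4 <;> ring
    have e2 : Real.cosh (2 * b * c / s) ≤ Real.exp (b * ‖x‖ ^ 2 / (2 * s ^ 2)) := by
      refine (Real.cosh_le_exp_half_sq _).trans (Real.exp_le_exp.2 ?_)
      have : (2 * b * c / s) ^ 2 / 2 = 2 * b ^ 2 * c ^ 2 / s ^ 2 := by
        field_simp
      rw [this, div_le_div_iff₀ (by positivity) (by positivity)]
      have h3 : b ^ 2 * c ^ 2 ≤ b * ‖x‖ ^ 2 * (1 / 4) := by
        rw [← hbR]
        nlinarith [sq_nonneg b]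
      nlinarith [sq_nonneg s]
    have e3 : b * ‖x‖ ^ 2 / (2 * s ^ 2) + -(b * ‖x‖ ^ 2 / s) ≤ -(b * ‖x‖ ^ 2 / (s + 1)) := by
      have h4 : b * ‖x‖ ^ 2 / s - b * ‖x‖ ^ 2 / (s + 1) = b * ‖x‖ ^ 2 / (s * (s + 1)) := by
        field_simp
        ring
      have h5 : b * ‖x‖ ^ 2 / (2 * s ^ 2) ≤ b * ‖x‖ ^ 2 / (s * (s + 1)) :=
        div_le_div_of_nonneg_left (by positivity) (by positivity) (by nlinarith)
      linarith
    have e4 : Real.exp (-(b * ‖y‖ ^ 2 / s)) ≤ 1 - b * ‖y‖ ^ 2 / s / 2 := by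
      refine exp_neg_le_one_sub_half (by positivity) ?_
      rw [div_le_one hs0]
      nlinarith
    rw [e1]
    calc s ^ (-a) * (Real.exp (-(b * (‖x‖ ^ 2 + ‖y‖ ^ 2) / s)) * Real.cosh (2 * b * c / s))
        ≤ s ^ (-a) * (Real.exp (-(b * (‖x‖ ^ 2 + ‖y‖ ^ 2) / s)) *
            Real.exp (b * ‖x‖ ^ 2 / (2 * s ^ 2))) := by gcongr
      _ = s ^ (-a) * (Real.exp (b * ‖x‖ ^ 2 / (2 * s ^ 2) + -(b * ‖x‖ ^ 2 / s)) *
            Real.exp (-(b * ‖y‖ ^ 2 / s))) := by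
          rw [← Real.exp_add, ← Real.exp_add]
          congr 2
          ring
      _ ≤ s ^ (-a) * (Real.exp (-(b * ‖x‖ ^ 2 / (s + 1))) * (1 - b * ‖y‖ ^ 2 / s / 2)) := by
          gcongr
      _ = A - A * b / (2 * s) * ‖y‖ ^ 2 := by
          rw [hA]
          field_simp
  have hint : ∫ y, K.J y * (A - A * b / (2 * s) * ‖y‖ ^ 2) = A * (1 - a / s) := by
    have h1 : ∀ y, K.J y * (A - A * b / (2 * s) * ‖y‖ ^ 2) =
        A * K.J y - A * b / (2 * s) * (K.J y * ‖y‖ ^ 2) := fun y => by ring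
    simp only [h1]
    rw [integral_sub (K.integrable.const_mul _)
      ((K.integrable_mul_continuous (by fun_prop)).const_mul _), integral_const_mul,
      integral_const_mul, K.integral_eq_one, ← Kernel.moment, ha]
    field_simp
  refine (K.avg_le_of_symm_le (K.heat_continuous s) (by fun_prop) hpt).trans ?_
  rw [hint]
  have ha0 : 0 ≤ a := by
    have := K.moment_pos hN
    positivity
  -- `(1 + 1 / s)^{-a} ≥ 1 - a / s`
  have hpow : s ^ (-a) * (1 - a / s) ≤ (s + 1) ^ (-a) := by
    have h1 : s + 1 = s * (1 + 1 / s) := by field_simp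
    have h2 : 0 < 1 + 1 / s := by positivity
    rw [h1, Real.mul_rpow hs0.le h2.le]
    refine mul_le_mul_of_nonneg_left ?_ (Real.rpow_nonneg hs0.le _)
    rw [Real.rpow_def_of_pos h2]
    have h3 := Real.log_le_sub_one_of_pos h2
    have h4 := Real.add_one_le_exp (Real.log (1 + 1 / s) * -a)
    have h5 : a * Real.log (1 + 1 / s) ≤ a * (1 / s) :=
      mul_le_mul_of_nonneg_left (by linarith) ha0
    rw [mul_one_div] at h5
    linarith
  calc A * (1 - a / s) = s ^ (-a) * (1 - a / s) * Real.exp (-(b * ‖x‖ ^ 2 / (s + 1))) := by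
        rw [hA]
        ring
    _ ≤ (s + 1) ^ (-a) * Real.exp (-(b * ‖x‖ ^ 2 / (s + 1))) := by gcongr
    _ = K.heat (s + 1) x := by rw [Kernel.heat, ← hb, ← ha]

theorem tendsto_heat_exponent (hN : 1 ≤ N) : Tendsto
    (fun n : ℕ => ((n : ℝ) + 1) ^ (-((4 * K.R ^ 2)⁻¹ * K.moment / 2))) atTop (𝓝 0) := by
  have hR := K.radius_pos hN
  have := K.moment_pos hN
  exact (tendsto_rpow_neg_atTop (by positivity)).comp
    (tendsto_atTop_add_const_right _ 1 tendsto_natCast_atTop_atTop)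

/-- A nonnegative integrable function that is harmonic for the kernel vanishes: its integral
against the spreading barriers is nondecreasing in time and tends to zero. -/
theorem eq_zero_of_conv_eq (hN : 1 ≤ N) {v : L1 N} (hv : 0 ≤ v) (h : K.conv v = v) : v = 0 := by
  have hv' := (Lp.coeFn_nonneg v).2 hv
  have hbd : ∀ s : ℝ, 0 < s → Integrable fun x => v x * K.heat s x := fun s hs =>
    Integrable.mul_bdd (c := s ^ (-((4 * K.R ^ 2)⁻¹ * K.moment / 2))) (L1.integrable_coeFn v)
      (K.heat_continuous s).aestronglyMeasurable (Eventually.of_forall fun x => by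
        rw [Real.norm_of_nonneg (K.heat_pos hs x).le]
        exact K.heat_le hs x)
  have hstep : ∀ s : ℝ, 1 ≤ s → ∫ x, v x * K.heat s x ≤ ∫ x, v x * K.heat (s + 1) x := by
    intro s hs
    have hs0 : 0 < s := by linarith
    have h1 := K.integral_conv_mul v (K.heat_continuous s) (fun x => by
        rw [abs_of_nonneg (K.heat_pos hs0 x).le]
        exact K.heat_le hs0 x)
    rw [h] at h1
    rw [h1]
    refine integral_mono_of_nonneg ?_ (hbd (s + 1) (by linarith)) ?_
    · filter_upwards [hv'] with x hx
      exact mul_nonneg hx (integral_nonneg fun y =>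
        mul_nonneg (K.nonneg y) (K.heat_pos hs0 _).le)
    · filter_upwards [hv'] with x hx
      exact mul_le_mul_of_nonneg_left (K.avg_heat_le hN hs x) hx
  have hle : ∀ n : ℕ, ∫ x, v x * K.heat 1 x ≤
      ((n : ℝ) + 1) ^ (-((4 * K.R ^ 2)⁻¹ * K.moment / 2)) * ‖v‖ := by
    intro n
    have h1 : ∫ x, v x * K.heat 1 x ≤ ∫ x, v x * K.heat ((n : ℝ) + 1) x := by
      induction n with
      | zero => simp
      | succ n ih =>
        refine ih.trans ?_
        push_cast
        exact hstep _ (by linarith [(Nat.cast_nonneg n : (0 : ℝ) ≤ n)])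
    refine h1.trans ?_
    rw [norm_eq_integral_of_nonneg hv, ← integral_const_mul]
    have hn : (0 : ℝ) < n + 1 := by positivity
    refine integral_mono_ae (hbd _ hn) ((L1.integrable_coeFn v).const_mul _) ?_
    filter_upwards [hv'] with x hx
    rw [mul_comm]
    exact mul_le_mul_of_nonneg_right (K.heat_le hn x) hx
  have hlim : ∫ x, v x * K.heat 1 x ≤ 0 := by
    have h1 := (K.tendsto_heat_exponent hN).mul_const ‖v‖
    rw [zero_mul] at h1
    exact ge_of_tendsto' h1 hle
  have hnn : 0 ≤ᵐ[volume] fun x => v x * K.heat 1 x := by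
    filter_upwards [hv'] with x hx
    exact mul_nonneg hx (K.heat_pos one_pos x).le
  have h0 := (integral_eq_zero_iff_of_nonneg_ae hnn (hbd 1 one_pos)).1
    (le_antisymm hlim (integral_nonneg_of_ae hnn))
  refine Lp.ext ?_
  filter_upwards [h0, Lp.coeFn_zero ℝ 1 (volume : Measure (Space N))] with x h1 h2
  rw [h2]
  exact (mul_eq_zero.1 h1).resolve_right (K.heat_pos one_pos x).ne'

end Kernel

/-- Uniqueness for the biobstacle problem. -/
theorem IsBOPSolution.unique {K : Kernel N} (hN : 1 ≤ N) {f w₁ w₂ : L1 N}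
    (h₁ : IsBOPSolution K f w₁) (h₂ : IsBOPSolution K f w₂) : w₁ = w₂ := by
  have h := K.eq_zero_of_conv_eq hN (abs_nonneg _) (h₁.abs_sub_eq h₂)
  rw [← norm_eq_zero, norm_abs_eq_norm, norm_eq_zero] at h
  exact sub_eq_zero.1 h

/-- Dominated data have a supersolution: with `p_s` the spreading barriers, it is a multiple of
`∑_{1 ≤ s ≤ n} p_s`, since `(I - J ∗) ∑ p_s ≥ p_1 - p_{n+1}` and `p_{n+1}` is uniformly small. -/
theorem IsDominated.exists_isControlledBy (K : Kernel N) (hN : 1 ≤ N) {f : L1 N}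
    (hf : IsDominated f) : ∃ W, IsControlledBy K f W := by
  obtain ⟨g₁, g₂, hg₁, hg₂, hfg⟩ := hf
  obtain ⟨C, hC0, hC⟩ : ∃ C, 0 < C ∧ ∀ x, g₁ x + g₂ x ≤ C * K.heat 1 x + 1 / 2 := by
    have hcont : Continuous fun x => g₁ x + g₂ x := hg₁.continuous.add hg₂.continuous
    have hvan : Tendsto (fun x => g₁ x + g₂ x) (cocompact (Space N)) (𝓝 0) := by
      simpa using hg₁.vanishing.add hg₂.vanishing
    have hev : ∀ᶠ x in cocompact (Space N), g₁ x + g₂ x < 1 / 2 :=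
      hvan.eventually_lt_const (by norm_num)
    obtain ⟨S, hS, hS2⟩ := mem_cocompact.1 hev
    obtain ⟨M, hM⟩ := hS.bddAbove_image
      (f := fun x => (g₁ x + g₂ x) / K.heat 1 x)
      (hcont.div (K.heat_continuous 1) fun x => (K.heat_pos one_pos x).ne').continuousOn
    refine ⟨max M 1, by positivity, fun x => ?_⟩
    have hp := K.heat_pos one_pos x
    by_cases hx : x ∈ S
    · have h1 : (g₁ x + g₂ x) / K.heat 1 x ≤ M := hM ⟨x, hx, rfl⟩
      rw [div_le_iff₀ hp] at h1
      nlinarith [le_max_left M 1]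
    · have h1 : g₁ x + g₂ x < 1 / 2 := hS2 hx
      have : 0 ≤ max M 1 * K.heat 1 x := by positivity
      linarith
  -- time `n` after which the barrier is below `1 / (2 C)`
  obtain ⟨n, hn⟩ := ((K.tendsto_heat_exponent hN).eventually_lt_const
    (show (0 : ℝ) < 1 / (2 * C) by positivity)).exists
  have hint : ∀ k : ℕ, Integrable (K.heat ((k : ℝ) + 1)) := fun k =>
    K.heat_integrable hN (by positivity)
  set p : ℕ → L1 N := fun k => (hint k).toL1 with hp
  have hpc : ∀ k, p k =ᵐ[volume] K.heat ((k : ℝ) + 1) := fun k => (hint k).coeFn_toL1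
  have hpk : ∀ k, K.conv (p k) ≤ p (k + 1) := by
    intro k
    refine coeFn_le_of_ae ?_
    filter_upwards [K.coeFn_conv (p k), hpc (k + 1)] with x h1 h2
    rw [h1, h2, K.avg_congr (hpc k)]
    push_cast
    exact K.avg_heat_le hN (by linarith [(Nat.cast_nonneg k : (0 : ℝ) ≤ k)]) x
  have hsum : ∀ m : ℕ, K.conv (∑ k ∈ Finset.range m, p k) + p 0 ≤
      (∑ k ∈ Finset.range m, p k) + p m := by
    intro m
    rw [← K.convL_apply, map_sum, ← Finset.sum_range_succ, Finset.sum_range_succ']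
    exact add_le_add_left (Finset.sum_le_sum fun k _ => hpk k) _
  refine ⟨C • ∑ k ∈ Finset.range n, p k, ?_, ?_⟩
  · refine smul_nonneg hC0.le (Finset.sum_nonneg fun k _ => (Lp.coeFn_nonneg _).1 ?_)
    filter_upwards [hpc k] with x hx
    rw [hx]
    exact (K.heat_pos (by positivity) x).le
  · set V := ∑ k ∈ Finset.range n, p k
    filter_upwards [hfg, hpc 0, hpc n, ae_le_of_le (hsum n), Lp.coeFn_add (K.conv V) (p 0),
      Lp.coeFn_add V (p n), Lp.coeFn_smul C V, Lp.coeFn_smul C (K.conv V)]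
      with x h1 h2 h3 h4 h5 h6 h7 h8
    rw [h5, h6, Pi.add_apply, Pi.add_apply, h2, h3, Nat.cast_zero, zero_add] at h4
    rw [K.conv_smul, h7, h8, Pi.smul_apply, Pi.smul_apply, smul_eq_mul, smul_eq_mul]
    have h9 : |f x| ≤ g₁ x + g₂ x := by
      rcases abs_cases (f x) with h | h <;>
        linarith [le_max_left (f x) 0, le_max_right (f x) 0, le_max_left (-f x) 0,
          le_max_right (-f x) 0]
    have h10 : C * K.heat ((n : ℝ) + 1) x ≤ 1 / 2 := by
      have := (K.heat_le (by positivity : (0 : ℝ) < n + 1) x).trans hn.le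
      calc C * K.heat ((n : ℝ) + 1) x ≤ C * (1 / (2 * C)) := by gcongr
        _ = 1 / 2 := by field_simp
    have h11 := mul_le_mul_of_nonneg_left h4 hC0.le
    have h12 := hC x
    linarith

/-! ### Ordinary differential equations in Banach spaces -/

section ODE

variable {E : Type*} [NormedAddCommGroup E] [NormedSpace ℝ E]

/-- Flow invariance: if `C` is closed and convex, and `x + F x ∈ C` for `x ∈ C`, then solutions
of `y' = F(y)` that start in `C` stay in `C`. -/
theorem mem_of_hasDerivWithinAt {F : E → E} {L : NNReal} (hF : LipschitzWith L F) {C : Set E}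
    (hC : IsClosed C) (hconv : Convex ℝ C) (hFC : ∀ x ∈ C, x + F x ∈ C) {y : ℝ → E}
    (hy : ContinuousOn y (Set.Ici 0))
    (hy' : ∀ t, 0 ≤ t → HasDerivWithinAt y (F (y t)) (Set.Ici t) t) (h0 : y 0 ∈ C) :
    ∀ t, 0 ≤ t → y t ∈ C := by
  intro T hT
  have hne : C.Nonempty := ⟨_, h0⟩
  -- one explicit Euler step of length `h ≤ 1` expands the distance to `C` by at most `1 + L h`
  have hstep : ∀ x h, 0 ≤ h → h ≤ 1 →
      Metric.infDist (x + h • F x) C ≤ (1 + L * h) * Metric.infDist x C := by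
    intro x h h0 h1
    have hpos : (0 : ℝ) < 1 + L * h := by positivity
    rw [mul_comm, ← div_le_iff₀ hpos]
    refine (Metric.le_infDist hne).2 fun c hc => ?_
    rw [div_le_iff₀ hpos]
    have hmem : c + h • F c ∈ C := by
      have := hconv hc (hFC c hc) (sub_nonneg.2 h1) h0 (by ring)
      convert this using 1
      module
    refine (Metric.infDist_le_dist_of_mem hmem).trans ?_
    have h2 := hF.dist_le_mul x c
    calc dist (x + h • F x) (c + h • F c) ≤ dist x c + dist (h • F x) (h • F c) :=
          dist_add_add_le _ _ _ _
      _ = dist x c + h * dist (F x) (F c) := by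
          rw [dist_smul₀, Real.norm_of_nonneg h0]
      _ ≤ dist x c + h * (L * dist x c) := by gcongr
      _ = dist x c * (1 + L * h) := by ring
  have key := le_gronwallBound_of_liminf_deriv_right_le (a := 0) (b := T) (δ := 0) (ε := 0)
    (K := L) (f := fun t => Metric.infDist (y t) C)
    (f' := fun t => L * Metric.infDist (y t) C)
    ((Metric.continuous_infDist_pt C).comp_continuousOn
      (hy.mono Set.Icc_subset_Ici_self)) ?_ (by rw [Metric.infDist_zero_of_mem h0])
    (fun x _ => by simp) T ⟨hT, le_rfl⟩
  · rw [gronwallBound_ε0_δ0] at key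
    exact (hC.mem_iff_infDist_zero hne).2 (le_antisymm key Metric.infDist_nonneg)
  intro t ht r hr
  have hd := (hasDerivWithinAt_iff_tendsto_slope.1 (hy' t ht.1))
  have hd2 : Tendsto (fun z => slope y t z) (𝓝[>] t) (𝓝 (F (y t))) := by
    refine hd.mono_left (nhdsWithin_mono _ ?_)
    intro z hz
    exact ⟨Set.Ioi_subset_Ici_self hz, ne_of_gt hz⟩
  have hd3 := (tendsto_iff_norm_sub_tendsto_zero.1 hd2)
  have hlt : ∀ᶠ z in 𝓝[>] t, ‖slope y t z - F (y t)‖ < r - L * Metric.infDist (y t) C :=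
    hd3.eventually_lt_const (sub_pos.2 hr)
  have hlt1 : ∀ᶠ z in 𝓝[>] t, z < t + 1 :=
    nhdsWithin_le_nhds (eventually_lt_nhds (by linarith))
  refine Eventually.frequently ?_
  filter_upwards [hlt, hlt1, self_mem_nhdsWithin] with z h1 h2 h3
  have h3 : t < z := h3
  have hz : 0 < z - t := sub_pos.2 h3
  have h4 := hstep (y t) (z - t) hz.le (by linarith)
  have h5 : dist (y z) (y t + (z - t) • F (y t)) = (z - t) * ‖slope y t z - F (y t)‖ := by
    rw [dist_eq_norm, ← Real.norm_of_nonneg hz.le, ← norm_smul, Real.norm_of_nonneg hz.le,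
      smul_sub, sub_smul_slope, vsub_eq_sub]
    congr 1
    abel
  have h6 := Metric.infDist_le_infDist_add_dist (s := C) (x := y z)
    (y := y t + (z - t) • F (y t))
  rw [h5] at h6
  rw [inv_mul_lt_iff₀ hz]
  have h7 := mul_lt_mul_of_pos_left h1 hz
  nlinarith

/-- Solutions in integrated form of `y' = F(y)`, `y(0) = x`, have a right derivative. -/
theorem hasDerivWithinAt_of_eq_integral [CompleteSpace E] {F : E → E} (hF : Continuous F) {x : E} {y : ℝ → E}
    (hy : ContinuousOn y (Set.Ici 0))
    (h : ∀ t, 0 ≤ t → y t = x + ∫ s in (0 : ℝ)..t, F (y s)) (t : ℝ) (ht : 0 ≤ t) :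
    HasDerivWithinAt y (F (y t)) (Set.Ici t) t := by
  have hFy : ContinuousOn (fun s => F (y s)) (Set.Ici 0) := hF.comp_continuousOn hy
  have hd : HasDerivWithinAt (fun s => x + ∫ r in (0 : ℝ)..s, F (y r)) (F (y t))
      (Set.Ici t) t := by
    refine HasDerivWithinAt.const_add _ ?_
    refine intervalIntegral.integral_hasDerivWithinAt_right (t := Set.Ioi t) ?_ ?_ ?_
    · exact (hFy.mono (by rw [Set.uIcc_of_le ht]; exact Set.Icc_subset_Ici_self)).intervalIntegrable
    · refine ContinuousOn.stronglyMeasurableAtFilter_nhdsWithin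
        (hFy.mono ?_) measurableSet_Ioi t
      exact fun s hs => ht.trans (le_of_lt hs)
    · exact (hFy t ht).mono fun s hs => ht.trans (le_of_lt hs)
  refine hd.congr (fun s hs => h s (ht.trans hs)) (h t ht)

/-- A curve with growth `‖g(s)‖ ≤ M e^{l s}` has a primitive with growth `(M / l) e^{l t}`. -/
theorem norm_exp_smul_integral_le {l : ℝ} (hl : 0 < l) {g : ℝ → E} {M t : ℝ} (hM : 0 ≤ M)
    (ht : 0 ≤ t) (hg : ∀ s, 0 ≤ s → ‖g s‖ ≤ M * Real.exp (l * s)) :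
    ‖Real.exp (-(l * t)) • ∫ s in (0 : ℝ)..t, g s‖ ≤ M / l := by
  have h1 : ‖∫ s in (0 : ℝ)..t, g s‖ ≤ ∫ s in (0 : ℝ)..t, M * Real.exp (l * s) := by
    refine intervalIntegral.norm_integral_le_of_norm_le ht
      (Eventually.of_forall fun s hs => hg s hs.1.le) ?_
    exact (by fun_prop : Continuous fun s => M * Real.exp (l * s)).intervalIntegrable _ _
  have h2 : ∫ s in (0 : ℝ)..t, M * Real.exp (l * s) = M * ((Real.exp (l * t) - 1) / l) := by
    rw [intervalIntegral.integral_const_mul, intervalIntegral.integral_comp_mul_left _ hl.ne',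
      integral_exp, mul_zero, Real.exp_zero, smul_eq_mul]
    ring
  rw [norm_smul, Real.norm_of_nonneg (Real.exp_pos _).le]
  calc _ ≤ Real.exp (-(l * t)) * (M * ((Real.exp (l * t) - 1) / l)) := by
        rw [← h2]
        gcongr
    _ = M / l * (1 - Real.exp (-(l * t))) := by
        rw [Real.exp_neg]
        field_simp
    _ ≤ M / l * 1 := by
        gcongr
        linarith [Real.exp_pos (-(l * t))]
    _ = M / l := mul_one _

open scoped BoundedContinuousFunction in
/-- Global existence for `y' = F(y)` with a Lipschitz right-hand side, in integrated form. In the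
unknown `v(t) = e^{-l t} y(t)`, bounded and continuous, the equation is a fixed point problem for a
contraction of ratio `L / l`; here `l = L + 1`. -/
theorem exists_eq_integral [CompleteSpace E] {F : E → E} {L : NNReal} (hF : LipschitzWith L F) (x : E) :
    ∃ y : ℝ → E, Continuous y ∧ ∀ t, 0 ≤ t → y t = x + ∫ s in (0 : ℝ)..t, F (y s) := by
  set l : ℝ := L + 1 with hl
  have hl0 : 0 < l := by positivity
  have hcont : ∀ v : ℝ →ᵇ E, Continuous fun s => F (Real.exp (l * s) • v s) := fun v =>
    hF.continuous.comp (by fun_prop)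
  have hprim : ∀ v : ℝ →ᵇ E,
      Continuous fun t => ∫ s in (0 : ℝ)..t, F (Real.exp (l * s) • v s) := fun v =>
    intervalIntegral.continuous_primitive (fun a b => (hcont v).intervalIntegrable a b) 0
  have hbound : ∀ (v : ℝ →ᵇ E) (s : ℝ), 0 ≤ s →
      ‖F (Real.exp (l * s) • v s)‖ ≤ (‖F 0‖ + L * ‖v‖) * Real.exp (l * s) := by
    intro v s hs
    have h1 := hF.norm_sub_le (Real.exp (l * s) • v s) 0
    have h2 := norm_sub_norm_le (F (Real.exp (l * s) • v s)) (F 0)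
    rw [sub_zero, norm_smul, Real.norm_of_nonneg (Real.exp_pos _).le] at h1
    have h3 : L * (Real.exp (l * s) * ‖v s‖) ≤ L * (Real.exp (l * s) * ‖v‖) := by
      gcongr
      exact v.norm_coe_le_norm s
    have h4 : 1 ≤ Real.exp (l * s) := Real.one_le_exp (by positivity)
    nlinarith [norm_nonneg (F 0)]
  let S : (ℝ →ᵇ E) → (ℝ →ᵇ E) := fun v => BoundedContinuousFunction.ofNormedAddCommGroup
    (fun t => Real.exp (-(l * max t 0)) •
      (x + ∫ s in (0 : ℝ)..max t 0, F (Real.exp (l * s) • v s)))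
    (by
      have := (hprim v).comp (continuous_id.max continuous_const : Continuous fun t : ℝ => max t 0)
      exact Continuous.smul (by fun_prop) (continuous_const.add this))
    (‖x‖ + (‖F 0‖ + L * ‖v‖) / l) (by
      intro t
      have ht : 0 ≤ max t 0 := le_max_right _ _
      rw [smul_add]
      refine norm_add_le_of_le ?_
        (norm_exp_smul_integral_le hl0 (by positivity) ht fun s hs => hbound v s hs)
      rw [norm_smul, Real.norm_of_nonneg (Real.exp_pos _).le]
      refine mul_le_of_le_one_left (norm_nonneg x) (Real.exp_le_one_iff.2 ?_)
      exact neg_nonpos.2 (by positivity))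
  have hS : ∀ v t, S v t = Real.exp (-(l * max t 0)) •
      (x + ∫ s in (0 : ℝ)..max t 0, F (Real.exp (l * s) • v s)) := fun v t => rfl
  have hcontr : ContractingWith (L / (L + 1)) S := by
    refine ⟨(div_lt_one (by positivity)).2 (lt_add_one L), ?_⟩
    refine LipschitzWith.of_dist_le_mul fun v w => ?_
    refine (BoundedContinuousFunction.dist_le (by positivity)).2 fun t => ?_
    have ht : 0 ≤ max t 0 := le_max_right _ _
    rw [dist_eq_norm, hS, hS, ← smul_sub, add_sub_add_left_eq_sub,
      ← intervalIntegral.integral_sub ((hcont v).intervalIntegrable _ _)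
        ((hcont w).intervalIntegrable _ _)]
    refine (norm_exp_smul_integral_le (M := L * dist v w) hl0 (by positivity) ht
      fun s hs => ?_).trans_eq ?_
    · refine (hF.norm_sub_le _ _).trans ?_
      rw [← smul_sub, norm_smul, Real.norm_of_nonneg (Real.exp_pos _).le, mul_assoc,
        mul_comm (dist v w), ← dist_eq_norm]
      gcongr
      exact BoundedContinuousFunction.dist_coe_le_dist s
    · push_cast
      rw [hl]
      ring
  set v := hcontr.fixedPoint with hv
  have hfix : S v = v := hcontr.fixedPoint_isFixedPt
  refine ⟨fun t => Real.exp (l * t) • v t, by fun_prop, fun t ht => ?_⟩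
  have := hS v t
  rw [hfix, max_eq_left ht] at this
  simp only
  rw [this, smul_smul, ← Real.exp_add, add_neg_cancel, Real.exp_zero, one_smul]

end ODE

variable {K : Kernel N}

/-! ### The evolution problem -/

/-- The right-hand side `J ∗ Γ(u) - Γ(u)` of the evolution equation. -/
noncomputable def Kernel.field (K : Kernel N) (u : L1 N) : L1 N :=
  K.conv (temperature u) - temperature u

theorem Kernel.field_lipschitz (K : Kernel N) : LipschitzWith 2 K.field := by
  refine LipschitzWith.of_dist_le_mul fun u v => ?_
  have h1 := K.norm_conv_le (temperature u - temperature v)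
  have h2 := temperature_lipschitz.norm_sub_le u v
  rw [NNReal.coe_one, one_mul] at h2
  have h3 : K.field u - K.field v =
      K.conv (temperature u - temperature v) - (temperature u - temperature v) := by
    rw [Kernel.field, Kernel.field, K.conv_sub]
    abel
  rw [dist_eq_norm, dist_eq_norm, h3, NNReal.coe_ofNat]
  linarith [norm_sub_le (K.conv (temperature u - temperature v)) (temperature u - temperature v)]

theorem Kernel.add_field_eq (K : Kernel N) (u : L1 N) :
    u + K.field u = K.conv (temperature u) + (u - temperature u) := by
  rw [Kernel.field]
  abel

/-- The Euler step of length one is order preserving. -/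
theorem Kernel.add_field_mono (K : Kernel N) : Monotone fun u => u + K.field u := by
  intro u v h
  simp only [K.add_field_eq]
  exact add_le_add (K.conv_mono (temperature_mono h)) (sub_temperature_mono h)

/-- The Euler step of length one is an `L¹` contraction. -/
theorem Kernel.norm_add_field_sub_le (K : Kernel N) (u v : L1 N) :
    ‖(u + K.field u) - (v + K.field v)‖ ≤ ‖u - v‖ := by
  rw [← norm_temperature_sub_add u v, K.add_field_eq, K.add_field_eq, add_sub_add_comm, ← K.conv_sub]
  refine norm_add_le_of_le (K.norm_conv_le _) le_rfl

theorem Kernel.field_neg (K : Kernel N) (u : L1 N) : K.field (-u) = -K.field u := by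
  rw [Kernel.field, Kernel.field, temperature_neg, K.conv_neg]
  abel

theorem Kernel.exists_isSolution (K : Kernel N) (f : L1 N) : ∃ u, IsSolution K f u := by
  obtain ⟨y, hy, hy'⟩ := exists_eq_integral K.field_lipschitz f
  exact ⟨y, hy.continuousOn, hy'⟩

namespace IsSolution

variable {f g : L1 N} {u v : ℝ → L1 N}

theorem hasDerivWithinAt (hu : IsSolution K f u) (t : ℝ) (ht : 0 ≤ t) :
    HasDerivWithinAt u (K.field (u t)) (Set.Ici t) t :=
  hasDerivWithinAt_of_eq_integral K.field_lipschitz.continuous hu.continuousOn hu.eq_integral t ht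

theorem apply_zero (hu : IsSolution K f u) : u 0 = f := by
  simpa using hu.eq_integral 0 le_rfl

/-- Flow invariance for pairs of solutions. -/
theorem pair_mem (hu : IsSolution K f u) (hv : IsSolution K g v) {C : Set (L1 N × L1 N)}
    (hC : IsClosed C) (hconv : Convex ℝ C)
    (hFC : ∀ x ∈ C, (x.1 + K.field x.1, x.2 + K.field x.2) ∈ C) (h0 : (f, g) ∈ C) (t : ℝ)
    (ht : 0 ≤ t) : (u t, v t) ∈ C := by
  have hF : LipschitzWith 2 fun x : L1 N × L1 N => (K.field x.1, K.field x.2) := by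
    have h1 := K.field_lipschitz.comp (LipschitzWith.prod_fst (α := L1 N) (β := L1 N))
    have h2 := K.field_lipschitz.comp (LipschitzWith.prod_snd (α := L1 N) (β := L1 N))
    simpa using h1.prodMk h2
  refine mem_of_hasDerivWithinAt hF hC hconv hFC (y := fun t => (u t, v t))
    (hu.continuousOn.prodMk hv.continuousOn) (fun s hs => ?_) ?_ t ht
  · exact (hu.hasDerivWithinAt s hs).prodMk (hv.hasDerivWithinAt s hs)
  · simpa only [hu.apply_zero, hv.apply_zero] using h0

/-- Comparison principle. -/
theorem le_of_le (hu : IsSolution K f u) (hv : IsSolution K g v) (h : f ≤ g) (t : ℝ)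
    (ht : 0 ≤ t) : u t ≤ v t := by
  refine hu.pair_mem hv (C := {x | x.1 ≤ x.2}) (isClosed_le continuous_fst continuous_snd) ?_
    (fun x hx => K.add_field_mono hx) h t ht
  intro x hx y hy a b ha hb _
  have hx : x.1 ≤ x.2 := hx
  have hy : y.1 ≤ y.2 := hy
  exact add_le_add (smul_le_smul_of_nonneg_left hx ha) (smul_le_smul_of_nonneg_left hy hb)

/-- The `L¹` contraction property of the evolution. -/
theorem norm_sub_le (hu : IsSolution K f u) (hv : IsSolution K g v) (t : ℝ)
    (ht : 0 ≤ t) : ‖u t - v t‖ ≤ ‖f - g‖ := by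
  refine hu.pair_mem hv (C := {x | ‖x.1 - x.2‖ ≤ ‖f - g‖})
    (isClosed_le (by fun_prop) continuous_const) ?_
    (fun x hx => (K.norm_add_field_sub_le _ _).trans hx) (le_refl ‖f - g‖) t ht
  have h1 : {x : L1 N × L1 N | ‖x.1 - x.2‖ ≤ ‖f - g‖} =
      (LinearMap.fst ℝ (L1 N) (L1 N) - LinearMap.snd ℝ (L1 N) (L1 N)) ⁻¹'
        Metric.closedBall 0 ‖f - g‖ := by
    ext x
    simp
  rw [h1]
  exact (convex_closedBall _ _).linear_preimage _

theorem eqOn (hu : IsSolution K f u) (hv : IsSolution K f v) : Set.EqOn u v (Set.Ici 0) := by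
  intro t ht
  have := hu.norm_sub_le hv t ht
  rw [sub_self, norm_zero] at this
  exact sub_eq_zero.1 (norm_le_zero_iff.1 this)

theorem neg (hu : IsSolution K f u) : IsSolution K (-f) (fun t => -u t) := by
  refine ⟨hu.continuousOn.neg, fun t ht => ?_⟩
  have h : ∀ s, K.conv (temperature (-u s)) - temperature (-u s) =
      -(K.conv (temperature (u s)) - temperature (u s)) := fun s => K.field_neg (u s)
  simp only [h, intervalIntegral.integral_neg]
  rw [hu.eq_integral t ht]
  abel

theorem zero : IsSolution K (0 : L1 N) (fun _ => 0) := by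
  refine ⟨continuousOn_const, fun t _ => ?_⟩
  rw [temperature_zero, ← K.convL_apply, map_zero]
  simp

theorem nonneg (hu : IsSolution K f u) (hf : 0 ≤ f) (t : ℝ) (ht : 0 ≤ t) : 0 ≤ u t :=
  zero.le_of_le hu hf t ht

theorem continuousOn_temperature (hu : IsSolution K f u) :
    ContinuousOn (fun t => temperature (u t)) (Set.Ici 0) :=
  temperature_lipschitz.continuous.comp_continuousOn hu.continuousOn

theorem intervalIntegrable_temperature (hu : IsSolution K f u) {s t : ℝ} (hs : 0 ≤ s)
    (ht : 0 ≤ t) : IntervalIntegrable (fun r => temperature (u r)) volume s t :=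
  (hu.continuousOn_temperature.mono (Set.uIcc_subset_Icc (b₂ := max s t)
    ⟨hs, le_max_left _ _⟩ ⟨ht, le_max_right _ _⟩ |>.trans Set.Icc_subset_Ici_self)).intervalIntegrable

end IsSolution

/-- The time integral `w(t) = ∫₀ᵗ Γ(u(s)) ds` of the temperature (the Baiocchi variable). -/
noncomputable def baiocchi (u : ℝ → L1 N) (t : ℝ) : L1 N :=
  ∫ s in (0 : ℝ)..t, temperature (u s)

namespace IsSolution

variable {f g : L1 N} {u v : ℝ → L1 N}

theorem eq_mesa (hu : IsSolution K f u) (t : ℝ) (ht : 0 ≤ t) :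
    u t = K.mesa f (baiocchi u t) := by
  have hint := hu.intervalIntegrable_temperature le_rfl ht
  have hint2 : IntervalIntegrable (fun s => K.conv (temperature (u s))) volume 0 t :=
    ⟨K.convL.integrable_comp hint.1, K.convL.integrable_comp hint.2⟩
  rw [hu.eq_integral t ht, Kernel.mesa, baiocchi, intervalIntegral.integral_sub hint2 hint,
    add_sub_assoc]
  congr 2
  exact K.convL.intervalIntegral_comp_comm hint

theorem norm_temperature_le (hu : IsSolution K f u) (t : ℝ) (ht : 0 ≤ t) :
    ‖temperature (u t)‖ ≤ ‖f‖ := by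
  refine (NonlocalStefan.norm_temperature_le _).trans ?_
  simpa using hu.norm_sub_le zero t ht

theorem baiocchi_sub (hu : IsSolution K f u) {s t : ℝ} (hs : 0 ≤ s) (hst : s ≤ t) :
    baiocchi u t - baiocchi u s = ∫ r in s..t, temperature (u r) :=
  intervalIntegral.integral_interval_sub_left
    (hu.intervalIntegrable_temperature le_rfl (hs.trans hst))
    (hu.intervalIntegrable_temperature le_rfl hs)

/-- For nonnegative controlled data, the time integral of the temperature stays below the
supersolution. -/
theorem baiocchi_le (hu : IsSolution K f u) {W : L1 N} (hW : IsControlledBy K f W) (t : ℝ)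
    (ht : 0 ≤ t) : baiocchi u t ≤ W := by
  -- `w` solves the autonomous equation `w' = Γ(f + J ∗ w - w)`
  have hmesa : LipschitzWith 2 fun w => temperature (K.mesa f w) := by
    have h : LipschitzWith 2 (K.mesa f) := by
      refine LipschitzWith.of_dist_le_mul fun v w => ?_
      have h3 : K.mesa f v - K.mesa f w = K.conv (v - w) - (v - w) := by
        rw [Kernel.mesa, Kernel.mesa, K.conv_sub]
        abel
      rw [dist_eq_norm, dist_eq_norm, h3, NNReal.coe_ofNat]
      linarith [_root_.norm_sub_le (K.conv (v - w)) (v - w), K.norm_conv_le (v - w)]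
    have h2 := temperature_lipschitz.comp h
    rwa [one_mul] at h2
  have hcont : ContinuousOn (baiocchi u) (Set.Ici 0) := by
    have hL : LipschitzOnWith ⟨‖f‖, norm_nonneg f⟩ (baiocchi u) (Set.Ici 0) := by
      have key : ∀ s t, 0 ≤ s → s ≤ t →
          dist (baiocchi u t) (baiocchi u s) ≤ ‖f‖ * dist t s := by
        intro s t hs hst
        rw [dist_eq_norm, hu.baiocchi_sub hs hst, Real.dist_eq]
        refine intervalIntegral.norm_integral_le_of_norm_le_const fun r hr => ?_
        rw [Set.uIoc_of_le hst] at hr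
        exact hu.norm_temperature_le r (hs.trans hr.1.le)
      refine LipschitzOnWith.of_dist_le_mul fun s hs t ht => ?_
      rcases le_total s t with h | h
      · rw [dist_comm, dist_comm s]
        exact key s t hs h
      · exact key t s ht h
    exact hL.continuousOn
  refine mem_of_hasDerivWithinAt (C := Set.Iic W) hmesa isClosed_Iic (convex_Iic W) ?_ hcont ?_
    (by simpa [baiocchi] using hW.nonneg) t ht
  · intro w hw
    have hle : f + K.conv w ≤ f + K.conv W := add_le_add_right (K.conv_mono hw) f
    refine coeFn_le_of_ae ?_
    filter_upwards [hW.le_one, (Lp.coeFn_nonneg W).2 hW.nonneg, ae_le_of_le hw, ae_le_of_le hle,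
      coeFn_temperature (K.mesa f w), Lp.coeFn_sub (f + K.conv w) w,
      Lp.coeFn_add w (temperature (K.mesa f w)), Lp.coeFn_add f (K.conv W)]
      with x h1 h2 h3 h4 h5 h6 h7 h8
    rw [h7, Pi.add_apply, h5, Kernel.mesa, h6, Pi.sub_apply]
    rw [h8, Pi.add_apply] at h4
    have h9 : (f + K.conv w) x - w x ≤ (W x - w x) + 1 := by
      linarith [le_abs_self (f x)]
    have h10 := Gam_mono h9
    rw [Gam_of_one_le (by linarith : 1 ≤ (W x - w x) + 1)] at h10
    linarith
  · intro s hs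
    have hd : HasDerivWithinAt (baiocchi u) (temperature (u s)) (Set.Ici s) s := by
      refine intervalIntegral.integral_hasDerivWithinAt_right (t := Set.Ioi s)
        (hu.intervalIntegrable_temperature le_rfl hs) ?_ ?_
      · refine ContinuousOn.stronglyMeasurableAtFilter_nhdsWithin
          (hu.continuousOn_temperature.mono fun r hr => hs.trans (le_of_lt hr)) measurableSet_Ioi s
      · exact (hu.continuousOn_temperature s hs).mono fun r hr => hs.trans (le_of_lt hr)
    rwa [hu.eq_mesa s hs] at hd

theorem baiocchi_mono (hu : IsSolution K f u) (hf : 0 ≤ f) {s t : ℝ} (hs : 0 ≤ s)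
    (hst : s ≤ t) : baiocchi u s ≤ baiocchi u t := by
  rw [← sub_nonneg, hu.baiocchi_sub hs hst]
  rw [intervalIntegral.integral_of_le hst]
  refine integral_nonneg_of_ae ?_
  refine (ae_restrict_iff' measurableSet_Ioc).2 (Eventually.of_forall fun r hr => ?_)
  exact temperature_nonneg (hu.nonneg hf r (hs.trans hr.1.le))

/-- For nonnegative controlled data the temperature dies out: its time integral converges. -/
theorem tendsto_temperature_of_isControlledBy (hu : IsSolution K f u) (hf : 0 ≤ f) {W : L1 N}
    (hW : IsControlledBy K f W) : Tendsto (fun t => temperature (u t)) atTop (𝓝 0) := by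
  obtain ⟨w, hw⟩ := exists_tendsto_of_monotone_of_le
    (w := fun t : Set.Ici (0 : ℝ) => baiocchi u t)
    (fun s t h => hu.baiocchi_mono hf s.2 h) (fun t => hu.baiocchi_le hW t t.2)
  have hw : Tendsto (baiocchi u) atTop (𝓝 w) := by
    have := (tendsto_comp_val_Ici_atTop (a := (0 : ℝ)) (f := baiocchi u)).1 hw
    exact this
  have hlim : Tendsto (fun t => temperature (u t)) atTop (𝓝 (temperature (K.mesa f w))) := by
    have h1 : Tendsto (fun t => K.mesa f (baiocchi u t)) atTop (𝓝 (K.mesa f w)) :=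
      ((tendsto_const_nhds.add ((K.continuous_conv.tendsto w).comp hw)).sub hw)
    have h2 := (temperature_lipschitz.continuous.tendsto _).comp h1
    refine h2.congr' ?_
    filter_upwards [eventually_ge_atTop 0] with t ht
    rw [Function.comp_apply, ← hu.eq_mesa t ht]
  -- the increments of the time integral over intervals of length one tend both to `0` and to the
  -- limit of the temperature
  have hinc : Tendsto (fun t => baiocchi u (t + 1) - baiocchi u t) atTop (𝓝 0) := by
    simpa using (hw.comp (tendsto_atTop_add_const_right _ 1 tendsto_id)).sub hw
  have hinc2 : Tendsto (fun t => baiocchi u (t + 1) - baiocchi u t) atTop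
      (𝓝 (temperature (K.mesa f w))) := by
    refine Metric.tendsto_atTop.2 fun ε hε => ?_
    obtain ⟨T, hT⟩ := Metric.tendsto_atTop.1 hlim (ε / 2) (half_pos hε)
    refine ⟨max T 0, fun t ht => ?_⟩
    have ht0 : 0 ≤ t := (le_max_right _ _).trans ht
    rw [dist_eq_norm, hu.baiocchi_sub ht0 (by linarith)]
    have hc : temperature (K.mesa f w) = ∫ r in t..(t + 1), temperature (K.mesa f w) := by
      simp
    rw [hc, ← intervalIntegral.integral_sub
      (hu.intervalIntegrable_temperature ht0 (by linarith)) (by simp)]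
    refine lt_of_le_of_lt (intervalIntegral.norm_integral_le_of_norm_le_const (C := ε / 2)
      fun r hr => ?_) ?_
    · rw [Set.uIoc_of_le (by linarith)] at hr
      rw [← dist_eq_norm]
      exact (hT r ((le_max_left _ _).trans (ht.trans hr.1.le))).le
    · simp [abs_of_pos, hε]
  rwa [tendsto_nhds_unique hinc2 hinc] at hlim

end IsSolution

/-! ### Density of the dominated data and the projection operator -/

theorem Kernel.isBarrier_heat (K : Kernel N) (hN : 1 ≤ N) {A : ℝ} (hA : 0 < A) :
    IsBarrier fun x => A * K.heat 1 x := by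
  have hR := K.radius_pos hN
  have hform : ∀ x, A * K.heat 1 x = A * Real.exp (-((4 * K.R ^ 2)⁻¹ * ‖x‖ ^ 2)) := fun x => by
    rw [Kernel.heat, Real.one_rpow, one_mul, div_one]
  refine ⟨continuous_const.mul (K.heat_continuous 1), (K.heat_integrable hN one_pos).const_mul A,
    ?_, fun x y h => ?_, fun x y h => ?_⟩
  · have h1 : Tendsto (fun x : Space N => (4 * K.R ^ 2)⁻¹ * ‖x‖ ^ 2) (cocompact (Space N))
        atTop :=
      ((tendsto_pow_atTop two_ne_zero).comp (tendsto_norm_cocompact_atTop (E := Space N))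
        |>.const_mul_atTop (by positivity))
    have h2 := (Real.tendsto_exp_neg_atTop_nhds_zero.comp h1).const_mul A
    rw [mul_zero] at h2
    refine h2.congr fun x => ?_
    rw [hform, Function.comp_apply]
  · rw [hform, hform, h]
  · rw [hform, hform]
    gcongr

/-- The dominated data include the continuous functions with compact support. -/
theorem dense_isDominated (hN : 1 ≤ N) (K : Kernel N) : Dense {f : L1 N | IsDominated f} := by
  refine (Lp.dense_hasCompactSupport_contDiff (F := ℝ) (E := Space N) (μ := volume)
    (p := 1) ENNReal.one_ne_top).mono ?_
  rintro f ⟨g, hfg, hg, hg'⟩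
  have hcont : Continuous fun x => g x * (K.heat 1 x)⁻¹ :=
    hg'.continuous.mul ((K.heat_continuous 1).inv₀ fun x => (K.heat_pos one_pos x).ne')
  obtain ⟨A, hA⟩ := hcont.bounded_above_of_compact_support hg.mul_right
  have hle : ∀ x, |g x| ≤ max A 1 * K.heat 1 x := by
    intro x
    have hp := K.heat_pos one_pos x
    have h1 := hA x
    rw [norm_mul, norm_inv, Real.norm_of_nonneg hp.le, Real.norm_eq_abs, ← div_eq_mul_inv,
      div_le_iff₀ hp] at h1
    exact h1.trans (mul_le_mul_of_nonneg_right (le_max_left _ _) hp.le)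
  have hb : IsBarrier fun x => max A 1 * K.heat 1 x := K.isBarrier_heat hN (by positivity)
  refine ⟨_, _, hb, hb, ?_⟩
  filter_upwards [hfg] with x hx
  rw [hx]
  have h0 := (abs_nonneg (g x)).trans (hle x)
  exact ⟨max_le ((le_abs_self _).trans (hle x)) h0, max_le ((neg_le_abs _).trans (hle x)) h0⟩

theorem IsDominated.exists_isBOPSolution (K : Kernel N) (hN : 1 ≤ N) {f : L1 N}
    (hf : IsDominated f) : ∃ w, IsBOPSolution K f w := by
  obtain ⟨W, hW⟩ := hf.exists_isControlledBy K hN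
  exact hW.exists_isBOPSolution

/-- The projection extends from the dominated data to an `L¹` contraction. -/
theorem exists_projection (hN : 1 ≤ N) (K : Kernel N) :
    ∃ P : L1 N → L1 N, LipschitzWith 1 P ∧
      ∀ f w : L1 N, IsBOPSolution K f w → P f = K.mesa f w := by
  have hd := dense_isDominated hN K
  choose w hw using fun f : {f : L1 N | IsDominated f} =>
    IsDominated.exists_isBOPSolution K hN f.2
  have hlip : LipschitzWith 1 fun f : {f : L1 N | IsDominated f} => K.mesa f (w f) := by
    refine LipschitzWith.of_dist_le_mul fun f g => ?_
    rw [NNReal.coe_one, one_mul, dist_eq_norm, Subtype.dist_eq, dist_eq_norm]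
    exact (hw f).norm_mesa_sub_le (hw g)
  have hP := hd.lipschitzWith_extend hlip
  refine ⟨_, hP, fun f v hv => ?_⟩
  -- both sides are contractions of the distance of `f` to the dense class
  have hle : ∀ g : L1 N, ‖hd.extend (fun f : {f : L1 N | IsDominated f} => K.mesa f (w f)) g -
      K.mesa f v‖ ≤ ‖g - f‖ := by
    intro g
    refine hd.induction ?_ (isClosed_le (by have := hP.continuous; fun_prop) (by fun_prop)) g
    intro g hg
    have h1 := hd.extend_eq hlip.continuous ⟨g, hg⟩
    rw [h1]
    exact (hw ⟨g, hg⟩).norm_mesa_sub_le hv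
  have h := hle f
  rw [sub_self, norm_zero] at h
  exact sub_eq_zero.1 (norm_le_zero_iff.1 h)

/-! ### Decay of the temperature -/

/-- The temperature dies out for all integrable data, since it is dominated by the temperature of
the solution with data `|f|`. -/
theorem IsSolution.tendsto_temperature (hN : 1 ≤ N) {f : L1 N} {u : ℝ → L1 N}
    (hu : IsSolution K f u) : Tendsto (fun t => temperature (u t)) atTop (𝓝 0) := by
  refine Metric.tendsto_atTop.2 fun ε hε => ?_
  obtain ⟨h, hh, hfh⟩ := (dense_isDominated hN K).exists_dist_lt f (half_pos hε)
  obtain ⟨W, hW⟩ := hh.exists_isControlledBy K hN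
  obtain ⟨U, hU⟩ := K.exists_isSolution |h|
  obtain ⟨V, hV⟩ := K.exists_isSolution |f|
  obtain ⟨T, hT⟩ := Metric.tendsto_atTop.1
    (hU.tendsto_temperature_of_isControlledBy (abs_nonneg h) hW.abs) (ε / 2) (half_pos hε)
  refine ⟨max T 0, fun t ht => ?_⟩
  have ht0 : 0 ≤ t := (le_max_right _ _).trans ht
  have h1 := hT t ((le_max_left _ _).trans ht)
  rw [dist_zero_right] at h1 ⊢
  have h2 : temperature (u t) ≤ temperature (V t) :=
    temperature_mono (hu.le_of_le hV (le_abs_self f) t ht0)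
  have h3 : -temperature (u t) ≤ temperature (V t) := by
    rw [← temperature_neg]
    exact temperature_mono (hu.neg.le_of_le hV (neg_le_abs f) t ht0)
  have h4 : ‖temperature (u t)‖ ≤ ‖temperature (V t)‖ :=
    norm_le_norm_of_abs_le_abs ((abs_le'.2 ⟨h2, h3⟩).trans (le_abs_self _))
  have h5 := temperature_lipschitz.norm_sub_le (V t) (U t)
  rw [NNReal.coe_one, one_mul] at h5
  have h6 := (hV.norm_sub_le hU t ht0).trans (norm_abs_sub_abs f h)
  rw [dist_eq_norm] at hfh
  have h7 := norm_sub_norm_le (temperature (V t)) (temperature (U t))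
  linarith

/-! ### Transience in dimension at least three -/

namespace Kernel

theorem integral_mul_inner_sq_map (K : Kernel N) (e : Space N ≃ₗᵢ[ℝ] Space N) (v : Space N) :
    ∫ y, K.J y * inner ℝ (e v) y ^ 2 = ∫ y, K.J y * inner ℝ v y ^ 2 := by
  rw [← e.measurePreserving.integral_comp e.toMeasurableEquiv.measurableEmbedding]
  congr 1
  ext y
  rw [K.radial (e y) y (e.norm_map y), e.inner_map_map]

/-- Isotropy of the second moments of the kernel. -/
theorem integral_mul_inner_sq (K : Kernel N) (hN : 1 ≤ N) (x : Space N) :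
    ∫ y, K.J y * inner ℝ x y ^ 2 = ‖x‖ ^ 2 * K.moment / N := by
  have hnorm : ∀ v w : Space N, ‖v‖ = ‖w‖ →
      ∫ y, K.J y * inner ℝ v y ^ 2 = ∫ y, K.J y * inner ℝ w y ^ 2 := by
    intro v w h
    rw [← Submodule.reflection_sub h, K.integral_mul_inner_sq_map]
  set e : Fin N → Space N := fun i => EuclideanSpace.single i (1 : ℝ) with he
  have hen : ∀ i, ‖e i‖ = 1 := fun i => by simp [he]
  have hsum : ∑ i, ∫ y, K.J y * inner ℝ (e i) y ^ 2 = K.moment := by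
    rw [← integral_finsetSum _ fun i _ => K.integrable_mul_continuous (by fun_prop)]
    rw [Kernel.moment]
    congr 1
    ext y
    rw [← Finset.mul_sum, EuclideanSpace.real_norm_sq_eq]
    congr 1
    refine Finset.sum_congr rfl fun i _ => ?_
    simp [he, EuclideanSpace.inner_single_left]
  let i₀ : Fin N := ⟨0, hN⟩
  have hconst : ∀ i, ∫ y, K.J y * inner ℝ (e i) y ^ 2 = ∫ y, K.J y * inner ℝ (e i₀) y ^ 2 :=
    fun i => hnorm _ _ (by rw [hen, hen])
  rw [Finset.sum_congr rfl fun i _ => hconst i, Finset.sum_const, Finset.card_univ,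
    Fintype.card_fin, nsmul_eq_mul] at hsum
  have hx : ∫ y, K.J y * inner ℝ x y ^ 2 = ‖x‖ ^ 2 * ∫ y, K.J y * inner ℝ (e i₀) y ^ 2 := by
    rw [hnorm x (‖x‖ • e i₀) (by rw [norm_smul, hen, mul_one, norm_norm]), ← integral_const_mul]
    congr 1
    ext y
    rw [real_inner_smul_left]
    ring
  have hN0 : (N : ℝ) ≠ 0 := by positivity
  rw [hx, ← hsum]
  field_simp

end Kernel

/-- A second order upper bound for `(1 + s)^{-1/4}`; the sharp quadratic coefficient would be
`5/32 < 11/64`. -/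
theorem one_add_rpow_neg_quarter_le {s : ℝ} (hs : |s| ≤ 3 / 100) :
    (1 + s) ^ (-(1 / 4 : ℝ)) ≤ 1 - s / 4 + 11 / 64 * s ^ 2 := by
  obtain ⟨h1, h2⟩ := abs_le.1 hs
  have hs0 : 0 < 1 + s := by linarith
  set r := 1 - s / 4 + 11 / 64 * s ^ 2 with hr
  have hr0 : 0 < r := by nlinarith [sq_nonneg s]
  have hp : 1 - s / 2 + 13 / 32 * s ^ 2 - 11 / 128 * s ^ 3 ≤ r ^ 2 := by
    rw [hr]
    nlinarith [sq_nonneg (s ^ 2)]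
  have hp0 : 0 ≤ 1 - s / 2 + 13 / 32 * s ^ 2 - 11 / 128 * s ^ 3 := by
    nlinarith [sq_nonneg s, mul_nonneg (sq_nonneg s) (sub_nonneg.2 h2)]
  have hr4 : (1 - s / 2 + 13 / 32 * s ^ 2 - 11 / 128 * s ^ 3) ^ 2 ≤ r ^ 4 := by
    calc _ ≤ (r ^ 2) ^ 2 := by gcongr
      _ = r ^ 4 := by ring
  have hkey : 1 ≤ (1 + s) * r ^ 4 := by
    refine le_trans ?_ (mul_le_mul_of_nonneg_left hr4 hs0.le)
    have hfac : (1 + s) * (1 - s / 2 + 13 / 32 * s ^ 2 - 11 / 128 * s ^ 3) ^ 2 = 1 + s ^ 2 *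
        (1 / 16 + s * (31 / 64 + s * (-335 / 1024 +
          s * (371 / 2048 + s * (-1023 / 16384 + s * (121 / 16384)))))) := by ring
    rw [hfac]
    have hb : ∀ {c q : ℝ}, |q| ≤ 1 → |c + s * q| ≤ |c| + 3 / 100 := by
      intro c q hq
      refine (abs_add_le _ _).trans ?_
      rw [abs_mul]
      have := mul_le_mul hs hq (abs_nonneg q) (by norm_num)
      linarith
    have hq : |31 / 64 + s * (-335 / 1024 +
          s * (371 / 2048 + s * (-1023 / 16384 + s * (121 / 16384))))| ≤ 1 := by
      have q1 : |-1023 / 16384 + s * (121 / 16384)| ≤ 1 :=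
        (hb (by norm_num [abs_le])).trans (by norm_num [abs_of_neg])
      have q2 : |371 / 2048 + s * (-1023 / 16384 + s * (121 / 16384))| ≤ 1 :=
        (hb q1).trans (by norm_num [abs_of_pos])
      have q3 : |-335 / 1024 + s * (371 / 2048 + s * (-1023 / 16384 + s * (121 / 16384)))| ≤ 1 :=
        (hb q2).trans (by norm_num [abs_of_neg])
      exact (hb q3).trans (by norm_num [abs_of_pos])
    have hsq : |s * (31 / 64 + s * (-335 / 1024 +
          s * (371 / 2048 + s * (-1023 / 16384 + s * (121 / 16384)))))| ≤ 3 / 100 := by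
      rw [abs_mul]
      calc _ ≤ 3 / 100 * 1 := mul_le_mul hs hq (abs_nonneg _) (by norm_num)
        _ = 3 / 100 := mul_one _
    have := (abs_le.1 hsq).1
    have h5 : 0 ≤ s ^ 2 := sq_nonneg s
    nlinarith
  have h3 : (1 + s)⁻¹ ≤ r ^ 4 := by
    rw [inv_le_iff_one_le_mul₀ hs0]
    linarith
  calc (1 + s) ^ (-(1 / 4 : ℝ)) = ((1 + s)⁻¹) ^ (1 / 4 : ℝ) := by
        rw [Real.rpow_neg hs0.le, Real.inv_rpow hs0.le]
    _ ≤ (r ^ 4) ^ (1 / 4 : ℝ) := by gcongr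
    _ = r := by
        rw [← Real.rpow_natCast, ← Real.rpow_mul hr0.le]
        norm_num

/-- The bounded superharmonic function `Φ(x) = (M + |x|²)^{-1/4}` with `M = 10⁴ R²`. The exponent
is below `(N - 2) / 2` in all dimensions `N ≥ 3`, and `M` is large enough for the Taylor remainders
to be negligible. -/
noncomputable def Kernel.potential (K : Kernel N) (x : Space N) : ℝ :=
  (10000 * K.R ^ 2 + ‖x‖ ^ 2) ^ (-(1 / 4 : ℝ))

namespace Kernel

theorem potential_base_pos (K : Kernel N) (hN : 1 ≤ N) (x : Space N) :
    0 < 10000 * K.R ^ 2 + ‖x‖ ^ 2 := by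
  have := K.radius_pos hN
  positivity

theorem potential_nonneg (K : Kernel N) (x : Space N) : 0 ≤ K.potential x :=
  Real.rpow_nonneg (add_nonneg (by positivity) (sq_nonneg ‖x‖)) _

theorem potential_continuous (K : Kernel N) (hN : 1 ≤ N) : Continuous K.potential := by
  unfold potential
  exact Continuous.rpow_const (by fun_prop) fun x => Or.inl (K.potential_base_pos hN x).ne'

theorem potential_le (K : Kernel N) (hN : 1 ≤ N) (x : Space N) :
    K.potential x ≤ K.potential 0 := by
  have h := K.potential_base_pos hN 0
  refine Real.rpow_le_rpow_of_nonpos h ?_ (by norm_num)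
  simp

/-- `J ∗ Φ ≤ Φ - (σ / 50) (M + |x|²)^{-5/4}` in dimension at least three. -/
theorem avg_potential_le (K : Kernel N) (hN : 3 ≤ N) (x : Space N) :
    K.avg K.potential x ≤
      K.potential x * (1 - K.moment / (50 * (10000 * K.R ^ 2 + ‖x‖ ^ 2))) := by
  have hN1 : 1 ≤ N := by omega
  have hR := K.radius_pos hN1
  set q := 10000 * K.R ^ 2 + ‖x‖ ^ 2 with hq
  have hq0 : 0 < q := K.potential_base_pos hN1 x
  set A := K.potential x with hA
  have hAq : A = q ^ (-(1 / 4 : ℝ)) := rfl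
  have hA0 : 0 ≤ A := K.potential_nonneg x
  set c : Space N → ℝ := fun y => inner ℝ x y with hc
  have hone : ∀ y : Space N, ‖y‖ ≤ K.R → ∀ τ : ℝ, |τ| ≤ ‖x‖ * ‖y‖ →
      (q + (2 * τ + ‖y‖ ^ 2)) ^ (-(1 / 4 : ℝ)) ≤
        A * (1 - (2 * τ + ‖y‖ ^ 2) / q / 4 + 11 / 64 * ((2 * τ + ‖y‖ ^ 2) / q) ^ 2) := by
    intro y hy τ hτ
    have hxR : ‖x‖ * ‖y‖ ≤ ‖x‖ * K.R := by gcongr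
    have hy2 : ‖y‖ ^ 2 ≤ K.R ^ 2 := by gcongr
    -- `100 R |x| ≤ (10⁴ R² + |x|²) / 2`
    have hamgm : 200 * (‖x‖ * K.R) ≤ q := by nlinarith [sq_nonneg (‖x‖ - 100 * K.R)]
    have hs : |(2 * τ + ‖y‖ ^ 2) / q| ≤ 3 / 100 := by
      rw [abs_div, abs_of_pos hq0, div_le_iff₀ hq0]
      have h1 : |2 * τ + ‖y‖ ^ 2| ≤ 2 * |τ| + ‖y‖ ^ 2 := by
        refine (abs_add_le _ _).trans ?_
        rw [abs_mul, abs_of_pos (two_pos : (0 : ℝ) < 2), abs_of_nonneg (sq_nonneg ‖y‖)]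
      nlinarith [sq_nonneg ‖x‖]
    have h0 : 0 ≤ 1 + (2 * τ + ‖y‖ ^ 2) / q := by linarith [(abs_le.1 hs).1]
    have hfac : q + (2 * τ + ‖y‖ ^ 2) = q * (1 + (2 * τ + ‖y‖ ^ 2) / q) := by field_simp
    rw [hfac, Real.mul_rpow hq0.le h0, hAq]
    exact mul_le_mul_of_nonneg_left (one_add_rpow_neg_quarter_le hs) (Real.rpow_nonneg hq0.le _)
  have hpt : ∀ y, ‖y‖ ≤ K.R → (K.potential (x - y) + K.potential (x + y)) / 2 ≤
      A - A / (4 * q) * ‖y‖ ^ 2 +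
        A * (11 / 64 / q ^ 2) * (4 * c y ^ 2 + K.R ^ 2 * ‖y‖ ^ 2) := by
    intro y hy
    have hy2 : ‖y‖ ^ 2 ≤ K.R ^ 2 := by gcongr
    have hcy : |c y| ≤ ‖x‖ * ‖y‖ := abs_real_inner_le_norm x y
    have h1 := hone y hy (-c y) (by rwa [abs_neg])
    have h2 := hone y hy (c y) hcy
    have e1 : K.potential (x - y) = (q + (2 * -c y + ‖y‖ ^ 2)) ^ (-(1 / 4 : ℝ)) := by
      rw [Kernel.potential, norm_sub_sq_real, hq]
      congr 1
      simp only [hc]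
      ring
    have e2 : K.potential (x + y) = (q + (2 * c y + ‖y‖ ^ 2)) ^ (-(1 / 4 : ℝ)) := by
      rw [Kernel.potential, norm_add_sq_real, hq]
      congr 1
      simp only [hc]
      ring
    rw [e1, e2]
    have h3 : A * (11 / 64 / q ^ 2) * (4 * c y ^ 2 + ‖y‖ ^ 2 * ‖y‖ ^ 2) ≤
        A * (11 / 64 / q ^ 2) * (4 * c y ^ 2 + K.R ^ 2 * ‖y‖ ^ 2) := by gcongr
    refine le_trans ?_ (add_le_add_right h3 _)
    refine (div_le_div_of_nonneg_right (add_le_add h1 h2) zero_le_two).trans_eq ?_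
    field_simp
    ring
  refine (K.avg_le_of_symm_le (K.potential_continuous hN1) (by fun_prop) hpt).trans ?_
  have hint : ∫ y, K.J y * (A - A / (4 * q) * ‖y‖ ^ 2 +
        A * (11 / 64 / q ^ 2) * (4 * c y ^ 2 + K.R ^ 2 * ‖y‖ ^ 2)) =
      A - A / (4 * q) * K.moment + A * (11 / 64 / q ^ 2) *
        (4 * (‖x‖ ^ 2 * K.moment / N) + K.R ^ 2 * K.moment) := by
    have h1 : ∀ y, K.J y * (A - A / (4 * q) * ‖y‖ ^ 2 +
        A * (11 / 64 / q ^ 2) * (4 * c y ^ 2 + K.R ^ 2 * ‖y‖ ^ 2)) =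
        A * K.J y + (A * (11 / 64 / q ^ 2) * K.R ^ 2 - A / (4 * q)) * (K.J y * ‖y‖ ^ 2) +
          A * (11 / 64 / q ^ 2) * 4 * (K.J y * c y ^ 2) := fun y => by ring
    have i1 : Integrable fun y => K.J y * ‖y‖ ^ 2 := K.integrable_mul_continuous (by fun_prop)
    have i2 : Integrable fun y => K.J y * c y ^ 2 := K.integrable_mul_continuous (by fun_prop)
    simp only [h1]
    have i3 : Integrable fun y => A * K.J y +
        (A * (11 / 64 / q ^ 2) * K.R ^ 2 - A / (4 * q)) * (K.J y * ‖y‖ ^ 2) :=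
      (K.integrable.const_mul _).add (i1.const_mul _)
    rw [integral_add i3 (i2.const_mul _),
      integral_add (K.integrable.const_mul _) (i1.const_mul _), integral_const_mul,
      integral_const_mul, integral_const_mul, K.integral_eq_one, ← Kernel.moment,
      K.integral_mul_inner_sq hN1]
    ring
  rw [hint]
  have hm := K.moment_pos hN1
  have h3 : ‖x‖ ^ 2 * K.moment / N ≤ q * K.moment / 3 := by
    have : (3 : ℝ) ≤ N := by exact_mod_cast hN
    have h4 : ‖x‖ ^ 2 ≤ q := by
      rw [hq]
      nlinarith [sq_nonneg K.R]
    gcongr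
  have h5 : K.R ^ 2 * K.moment ≤ q * K.moment / 10000 := by
    have : K.R ^ 2 ≤ q / 10000 := by
      rw [hq]
      nlinarith [sq_nonneg ‖x‖]
    calc K.R ^ 2 * K.moment ≤ q / 10000 * K.moment := by gcongr
      _ = q * K.moment / 10000 := by ring
  calc A - A / (4 * q) * K.moment + A * (11 / 64 / q ^ 2) *
        (4 * (‖x‖ ^ 2 * K.moment / N) + K.R ^ 2 * K.moment)
      ≤ A - A / (4 * q) * K.moment + A * (11 / 64 / q ^ 2) *
        (4 * (q * K.moment / 3) + q * K.moment / 10000) := by gcongr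
    _ = A * (1 - (1 / 4 - 11 / 64 * (4 / 3 + 1 / 10000)) * (K.moment / q)) := by
        field_simp
        ring
    _ ≤ A * (1 - 1 / 50 * (K.moment / q)) := by
        have : 0 ≤ K.moment / q := by positivity
        gcongr
        norm_num
    _ = A * (1 - K.moment / (50 * q)) := by
        congr 2
        field_simp

/-- In dimension at least three the kernel is dominated by `(I - J ∗) k` for some bounded `k`. -/
theorem exists_le_potential (K : Kernel N) (hN : 3 ≤ N) :
    ∃ C, 0 < C ∧ ∀ x, K.J x ≤ C * (K.potential x - K.avg K.potential x) := by
  have hN1 : 1 ≤ N := by omega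
  have hR := K.radius_pos hN1
  have hm := K.moment_pos hN1
  obtain ⟨B, hB0, hB⟩ := K.exists_bound
  have hlow : ∀ x, K.potential x * (K.moment / (50 * (10000 * K.R ^ 2 + ‖x‖ ^ 2))) ≤
      K.potential x - K.avg K.potential x := fun x => by
    linarith [K.avg_potential_le hN x]
  set m := (10000 * K.R ^ 2 + K.R ^ 2) ^ (-(1 / 4 : ℝ)) *
    (K.moment / (50 * (10000 * K.R ^ 2 + K.R ^ 2))) with hmdef
  have hm0 : 0 < m := by positivity
  refine ⟨B / m, by positivity, fun x => ?_⟩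
  rcases le_or_gt ‖x‖ K.R with hx | hx
  · have h1 : m ≤ K.potential x * (K.moment / (50 * (10000 * K.R ^ 2 + ‖x‖ ^ 2))) := by
      have hp := K.potential_base_pos hN1 x
      have hle : 10000 * K.R ^ 2 + ‖x‖ ^ 2 ≤ 10000 * K.R ^ 2 + K.R ^ 2 := by gcongr
      rw [hmdef, Kernel.potential]
      refine mul_le_mul (Real.rpow_le_rpow_of_nonpos hp hle (by norm_num)) (by gcongr)
        (by positivity) (Real.rpow_nonneg hp.le _)
    calc K.J x ≤ B := hB x
      _ = B / m * m := by field_simp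
      _ ≤ B / m * (K.potential x - K.avg K.potential x) := by
          gcongr
          exact h1.trans (hlow x)
  · rw [K.apply_eq_zero_of_lt hx]
    refine mul_nonneg (by positivity) (le_trans ?_ (hlow x))
    have := K.potential_nonneg x
    positivity

/-- Transience: `J ∗ v` is bounded by the `L¹` norm of `F`, if `v ≥ 0` and `v - J ∗ v ≤ F`. -/
theorem exists_conv_le (K : Kernel N) (hN : 3 ≤ N) :
    ∃ C, 0 < C ∧ ∀ v F : L1 N, 0 ≤ v → v - K.conv v ≤ F →
      ∀ᵐ x, K.conv v x ≤ C * ‖F‖ := by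
  have hN1 : 1 ≤ N := by omega
  obtain ⟨C, hC0, hC⟩ := K.exists_le_potential hN
  have hcont := K.potential_continuous hN1
  set B := K.potential 0 with hB
  have hB0 : 0 < B := Real.rpow_pos_of_pos (K.potential_base_pos hN1 0) _
  refine ⟨C * B, by positivity, fun v F hv hF => ?_⟩
  have hv' := (Lp.coeFn_nonneg v).2 hv
  filter_upwards [K.coeFn_conv v] with x hx
  set φ : Space N → ℝ := fun y => K.potential (x - y) with hφ
  have hφc : Continuous φ := by fun_prop
  have hφb : ∀ y, |φ y| ≤ B := fun y => by
    rw [abs_of_nonneg (K.potential_nonneg _)]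
    exact K.potential_le hN1 _
  have hφavg : ∀ y, K.avg φ y = K.avg K.potential (x - y) := fun y => by
    rw [K.avg_eq_add, avg]
    simp only [hφ, sub_add_eq_sub_sub]
  have havg : ∀ y, |K.avg φ y| ≤ B := by
    intro y
    have h1 : 0 ≤ K.avg φ y :=
      integral_nonneg fun z => mul_nonneg (K.nonneg z) (K.potential_nonneg _)
    rw [abs_of_nonneg h1]
    calc K.avg φ y ≤ ∫ z, K.J z * B :=
          integral_mono (K.integrable_mul_continuous (by fun_prop))
            (K.integrable.mul_const B) fun z =>
              mul_le_mul_of_nonneg_left (K.potential_le hN1 _) (K.nonneg z)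
      _ = B := by rw [integral_mul_const, K.integral_eq_one, one_mul]
  have hbd : ∀ w : L1 N, Integrable fun y => w y * φ y := fun w =>
    Integrable.mul_bdd (c := B) (L1.integrable_coeFn w) hφc.aestronglyMeasurable
      (Eventually.of_forall hφb)
  have havgm : AEStronglyMeasurable (K.avg φ) volume :=
    (K.hasCompactSupport.continuous_convolution_left (ContinuousLinearMap.mul ℝ ℝ)
      K.continuous hφc.locallyIntegrable).aestronglyMeasurable
  have hbda : Integrable fun y => v y * K.avg φ y :=
    Integrable.mul_bdd (c := B) (L1.integrable_coeFn v) havgm (Eventually.of_forall havg)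
  have hpair : ∫ y, v y * (φ y - K.avg φ y) = ∫ y, (v - K.conv v) y * φ y := by
    have h1 : ∀ y, v y * (φ y - K.avg φ y) = v y * φ y - v y * K.avg φ y := fun y => by ring
    simp only [h1]
    rw [integral_sub (hbd v) hbda, ← K.integral_conv_mul v hφc hφb,
      ← integral_sub (hbd v) (hbd _)]
    refine integral_congr_ae ?_
    filter_upwards [Lp.coeFn_sub v (K.conv v)] with y hy
    rw [hy, Pi.sub_apply]
    ring
  have hint3 : Integrable fun y => v y * (φ y - K.avg φ y) := by
    refine ((hbd v).sub hbda).congr (Eventually.of_forall fun y => ?_)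
    simp only [Pi.sub_apply]
    ring
  rw [hx, avg_eq]
  calc ∫ y, K.J (x - y) * v y ≤ ∫ y, C * (v y * (φ y - K.avg φ y)) := by
        refine integral_mono_of_nonneg ?_ (hint3.const_mul C) ?_
        · filter_upwards [hv'] with y hy
          exact mul_nonneg (K.nonneg _) hy
        · filter_upwards [hv'] with y hy
          have hy : 0 ≤ v y := hy
          have h2 := mul_le_mul_of_nonneg_right (hC (x - y)) hy
          simp only [hφavg]
          linarith
    _ = C * ∫ y, (v - K.conv v) y * φ y := by rw [integral_const_mul, hpair]
    _ ≤ C * (‖F‖ * B) := by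
        gcongr
        rw [L1.norm_eq_integral_norm, ← integral_mul_const]
        refine integral_mono_ae (hbd _) ((L1.integrable_coeFn _).norm.mul_const B) ?_
        filter_upwards [ae_le_of_le hF] with y hy
        have h0 : 0 ≤ φ y := K.potential_nonneg _
        calc (v - K.conv v) y * φ y ≤ F y * φ y := mul_le_mul_of_nonneg_right hy h0
          _ ≤ ‖F y‖ * φ y := mul_le_mul_of_nonneg_right (Real.le_norm_self _) h0
          _ ≤ ‖F y‖ * B := mul_le_mul_of_nonneg_left (K.potential_le hN1 _) (norm_nonneg _)
    _ = C * B * ‖F‖ := by ring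

end Kernel

/-- In dimension at least three, a solution of the biobstacle problem exists for all integrable
data: approximate them by dominated data. The sets `{w ≠ 0}` have uniformly bounded measure,
since `|f̃| = 1` there, and on sets of finite measure transience controls the `L¹` norm. -/
theorem exists_isBOPSolution_of_three_le (K : Kernel N) (hN : 3 ≤ N) (f : L1 N) :
    ∃ w, IsBOPSolution K f w := by
  have hN1 : 1 ≤ N := by omega
  obtain ⟨C, hC0, hC⟩ := K.exists_conv_le hN
  have hmeas : ∀ w : L1 N, MeasurableSet {x | w x ≠ 0} := fun w =>
    (Lp.stronglyMeasurable w).measurable (measurableSet_singleton 0).compl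
  -- the complement of the coincidence set has measure at most `‖f‖`
  have hsupp : ∀ {g w : L1 N}, IsBOPSolution K g w →
      volume {x | w x ≠ 0} ≤ ENNReal.ofReal ‖g‖ := by
    intro g w hw
    have h1 := hw.norm_mesa_sub_le (isBOPSolution_zero K)
    have h0 : K.mesa 0 0 = (0 : L1 N) := by
      rw [Kernel.mesa, ← K.convL_apply, map_zero, add_zero, sub_zero]
    rw [h0, sub_zero, sub_zero, L1.norm_eq_integral_norm] at h1
    rw [← setLIntegral_one]
    calc ∫⁻ _ in {x | w x ≠ 0}, 1 ≤ ∫⁻ x in {x | w x ≠ 0}, ‖K.mesa g w x‖ₑ := by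
          refine lintegral_mono_ae ((ae_restrict_iff' (hmeas w)).2 ?_)
          filter_upwards [hw] with x hx hx0
          have h2 := hx.1 hx0
          rw [h2]
          rcases lt_or_gt_of_ne hx0 with h | h
          · rw [Real.sign_of_neg h]
            simp
          · rw [Real.sign_of_pos h]
            simp
      _ ≤ ∫⁻ x, ‖K.mesa g w x‖ₑ := setLIntegral_le_lintegral _ _
      _ = ENNReal.ofReal (∫ x, ‖K.mesa g w x‖) :=
          (ofReal_integral_norm_eq_lintegral_enorm (L1.integrable_coeFn _)).symm
      _ ≤ ENNReal.ofReal ‖g‖ := ENNReal.ofReal_le_ofReal h1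
  -- Lipschitz dependence of the solution on the data
  have hlip : ∀ {g₁ w₁ g₂ w₂ : L1 N}, IsBOPSolution K g₁ w₁ → IsBOPSolution K g₂ w₂ →
      ‖w₁ - w₂‖ ≤ (1 + C * (‖g₁‖ + ‖g₂‖)) * (2 * ‖g₁ - g₂‖) := by
    intro g₁ w₁ g₂ w₂ h₁ h₂
    set d := w₁ - w₂ with hd
    set F := |d - K.conv d| with hF
    have hFle : ‖F‖ ≤ 2 * ‖g₁ - g₂‖ := by
      have h3 : d - K.conv d = (g₁ - g₂) - (K.mesa g₁ w₁ - K.mesa g₂ w₂) := by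
        rw [hd, K.conv_sub, Kernel.mesa, Kernel.mesa]
        abel
      rw [hF, norm_abs_eq_norm, h3]
      have := norm_sub_le (g₁ - g₂) (K.mesa g₁ w₁ - K.mesa g₂ w₂)
      linarith [h₁.norm_mesa_sub_le h₂]
    -- `|d|` is a subsolution: `|d| - J ∗ |d| ≤ F`
    have hsub : |d| - K.conv |d| ≤ F := by
      have h1 : |d| ≤ |d - K.conv d| + |K.conv d| := by
        simpa using abs_add_le (d - K.conv d) (K.conv d)
      rw [sub_le_iff_le_add]
      exact h1.trans (add_le_add_right (K.abs_conv_le d) _)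
    set E := {x | w₁ x ≠ 0} ∪ {x | w₂ x ≠ 0} with hE
    have hEm : MeasurableSet E := (hmeas w₁).union (hmeas w₂)
    have hEle : volume E ≤ ENNReal.ofReal (‖g₁‖ + ‖g₂‖) := by
      rw [ENNReal.ofReal_add (norm_nonneg _) (norm_nonneg _)]
      exact (measure_union_le _ _).trans (add_le_add (hsupp h₁) (hsupp h₂))
    have hEfin : volume E ≠ ⊤ := ne_top_of_le_ne_top ENNReal.ofReal_ne_top hEle
    have hEreal : volume.real E ≤ ‖g₁‖ + ‖g₂‖ :=
      ENNReal.toReal_le_of_le_ofReal (by positivity) hEle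
    have hEind : IntegrableOn (fun _ => C * ‖F‖) E := integrableOn_const hEfin
    have hpt : ∀ᵐ x, ‖d x‖ ≤ ‖F x‖ + E.indicator (fun _ => C * ‖F‖) x := by
      filter_upwards [hC |d| F (abs_nonneg d) hsub, ae_le_of_le hsub, Lp.coeFn_abs d,
        Lp.coeFn_sub |d| (K.conv |d|), Lp.coeFn_sub w₁ w₂] with x h1 h2 h3 h4 h5
      by_cases hx : x ∈ E
      · rw [Set.indicator_of_mem hx, Real.norm_eq_abs, ← h3]
        rw [h4, Pi.sub_apply] at h2
        linarith [Real.le_norm_self (F x)]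
      · rw [Set.indicator_of_notMem hx, add_zero]
        have hx1 : w₁ x = 0 := by
          by_contra h
          exact hx (Or.inl h)
        have hx2 : w₂ x = 0 := by
          by_contra h
          exact hx (Or.inr h)
        rw [hd, h5, Pi.sub_apply, hx1, hx2, sub_zero, norm_zero]
        exact norm_nonneg _
    have hdF : ‖d‖ ≤ ‖F‖ + volume.real E * (C * ‖F‖) := by
      have i1 : Integrable fun x => ‖F x‖ := (L1.integrable_coeFn F).norm
      have i2 := (integrable_indicator_iff hEm).2 hEind
      rw [L1.norm_eq_integral_norm d]
      refine (integral_mono_ae (L1.integrable_coeFn d).norm (i1.add i2) hpt).trans_eq ?_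
      have h5 : ∫ x, E.indicator (fun _ => C * ‖F‖) x = volume.real E * (C * ‖F‖) := by
        rw [integral_indicator_const _ hEm, smul_eq_mul]
      have h6 := integral_add i1 i2
      rw [h5, ← L1.norm_eq_integral_norm F] at h6
      exact h6
    calc ‖d‖ ≤ ‖F‖ + volume.real E * (C * ‖F‖) := hdF
      _ ≤ ‖F‖ + (‖g₁‖ + ‖g₂‖) * (C * ‖F‖) := by gcongr
      _ = (1 + C * (‖g₁‖ + ‖g₂‖)) * ‖F‖ := by ring
      _ ≤ (1 + C * (‖g₁‖ + ‖g₂‖)) * (2 * ‖g₁ - g₂‖) := by gcongr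
  obtain ⟨g, hg, hgf⟩ := mem_closure_iff_seq_limit.1 (dense_isDominated hN1 K f)
  choose w hw using fun n => IsDominated.exists_isBOPSolution K hN1 (hg n)
  obtain ⟨B, hB⟩ := hgf.norm.bddAbove_range
  have hB : ∀ n, ‖g n‖ ≤ B := fun n => hB ⟨n, rfl⟩
  have hB0 : 0 ≤ B := (norm_nonneg _).trans (hB 0)
  have hcauchy : CauchySeq w := by
    refine Metric.cauchySeq_iff.2 fun ε hε => ?_
    have hD : 0 < (1 + C * (B + B)) * 2 := by positivity
    obtain ⟨n, hn⟩ := Metric.cauchySeq_iff.1 hgf.cauchySeq _ (div_pos hε hD)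
    refine ⟨n, fun k hk l hl => ?_⟩
    have h1 := hn k hk l hl
    rw [dist_eq_norm, lt_div_iff₀ hD] at h1
    rw [dist_eq_norm]
    calc ‖w k - w l‖ ≤ (1 + C * (‖g k‖ + ‖g l‖)) * (2 * ‖g k - g l‖) := hlip (hw k) (hw l)
      _ ≤ (1 + C * (B + B)) * (2 * ‖g k - g l‖) := by
          gcongr
          · exact hB k
          · exact hB l
      _ = ‖g k - g l‖ * ((1 + C * (B + B)) * 2) := by ring
      _ < ε := h1
  obtain ⟨v, hv⟩ := cauchySeq_tendsto_of_complete hcauchy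
  refine ⟨v, (isBOPSolution_iff K f v).2 (tendsto_nhds_unique hv ?_)⟩
  have h1 : Tendsto (fun n => temperature (g n + K.conv (w n))) atTop
      (𝓝 (temperature (f + K.conv v))) :=
    (temperature_lipschitz.continuous.tendsto _).comp
      (hgf.add ((K.continuous_conv.tendsto v).comp hv))
  exact h1.congr fun n => (hw n).temperature_eq

/-! ### Distributional supports and separation -/

/-- An integrable function vanishes almost everywhere on open sets on which it vanishes as a
distribution. -/
theorem ae_eq_zero_of_forall_integral {g : Space N → ℝ} (hg : Integrable g) {O : Set (Space N)}
    (hO : IsOpen O) (h : ∀ φ : Space N → ℝ, ContDiff ℝ ∞ φ → HasCompactSupport φ →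
      tsupport φ ⊆ O → ∫ x, g x * φ x = 0) : ∀ᵐ x, x ∈ O → g x = 0 := by
  refine hO.ae_eq_zero_of_integral_contDiff_smul_eq_zero (hg.locallyIntegrable.locallyIntegrableOn O)
    fun φ h1 h2 h3 => ?_
  simpa only [smul_eq_mul, mul_comm] using h φ h1 h2 h3

theorem ae_mem_distSupport {g : Space N → ℝ} (hg : Integrable g) :
    ∀ᵐ x, g x ≠ 0 → x ∈ distSupport g := by
  obtain ⟨T, hT, hTS, hTeq⟩ := TopologicalSpace.isOpen_sUnion_countable
    {O : Set (Space N) | IsOpen O ∧ ∀ φ : Space N → ℝ, ContDiff ℝ ∞ φ → HasCompactSupport φ →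
      tsupport φ ⊆ O → ∫ x, g x * φ x = 0} fun O hO => hO.1
  have h : ∀ᵐ x, ∀ O ∈ T, x ∈ O → g x = 0 :=
    (ae_ball_iff hT).2 fun O hO => ae_eq_zero_of_forall_integral hg (hTS hO).1 (hTS hO).2
  filter_upwards [h] with x hx hgx
  rw [distSupport, ← hTeq]
  rintro ⟨O, hO, hxO⟩
  exact hgx (hx O hO hxO)

/-- The distributional support is monotone on nonnegative integrable functions. -/
theorem distSupport_mono {g h : Space N → ℝ} (hh : Integrable h)
    (hgh : ∀ᵐ x, 0 ≤ g x ∧ g x ≤ h x) : distSupport g ⊆ distSupport h := by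
  refine Set.compl_subset_compl.2 (Set.sUnion_subset_sUnion ?_)
  rintro O ⟨hO, hφ⟩
  refine ⟨hO, fun φ _ _ h3 => ?_⟩
  refine integral_eq_zero_of_ae ?_
  filter_upwards [ae_eq_zero_of_forall_integral hh hO hφ, hgh] with x hx hx2
  by_cases hxO : x ∈ O
  · have h4 := hx hxO
    have h5 : g x = 0 := by linarith
    simp [h5]
  · have : φ x = 0 := image_eq_zero_of_notMem_tsupport fun h => hxO (h3 h)
    simp [this]

theorem distSupport_congr {g h : Space N → ℝ} (hgh : g =ᵐ[volume] h) :
    distSupport g = distSupport h := by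
  have key : ∀ φ : Space N → ℝ, ∫ x, g x * φ x = ∫ x, h x * φ x := fun φ => by
    refine integral_congr_ae ?_
    filter_upwards [hgh] with x hx
    rw [hx]
  simp only [distSupport, key]

/-- If the positive and the negative part of `v` are at distance at least the radius of the kernel,
then `J ∗ v` is nonnegative where `v` is positive. -/
theorem Kernel.conv_nonneg_of_separatedBy (K : Kernel N) (hN : 1 ≤ N) {v : L1 N}
    (h : SeparatedBy K.R (distSupport fun x => max (v x) 0)
      (distSupport fun x => max (-v x) 0)) : ∀ᵐ x, 0 < v x → 0 ≤ K.conv v x := by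
  have hv := L1.integrable_coeFn v
  filter_upwards [K.coeFn_conv v, ae_mem_distSupport hv.pos_part] with x h1 h2 hpos
  have hx := h2 (by rw [max_eq_left hpos.le]; exact hpos.ne')
  rw [h1, K.avg_eq]
  refine integral_nonneg_of_ae ?_
  filter_upwards [ae_mem_distSupport hv.neg_part] with y hy
  change 0 ≤ K.J (x - y) * v y
  rcases le_or_gt 0 (v y) with h3 | h3
  · exact mul_nonneg (K.nonneg _) h3
  · have h4 := hy (by rw [max_eq_left (by linarith)]; linarith)
    have h5 := h x hx y h4
    rw [dist_eq_norm] at h5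
    rw [K.apply_eq_zero_of_le hN h5, zero_mul]

theorem NonInteracting.neg {u : ℝ → L1 N} (h : NonInteracting K u) :
    NonInteracting K (fun t => -u t) := by
  intro t ht x hx y hy
  have h1 : (fun x => max (temperature (-u t) x) 0) =ᵐ[volume]
      fun x => max (-temperature (u t) x) 0 := by
    rw [temperature_neg]
    filter_upwards [Lp.coeFn_neg (temperature (u t))] with x hx
    rw [hx, Pi.neg_apply]
  have h2 : (fun x => max (-temperature (-u t) x) 0) =ᵐ[volume]
      fun x => max (temperature (u t) x) 0 := by
    rw [temperature_neg]
    filter_upwards [Lp.coeFn_neg (temperature (u t))] with x hx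
    rw [hx, Pi.neg_apply, neg_neg]
  rw [distSupport_congr h1] at hx
  rw [distSupport_congr h2] at hy
  rw [dist_comm]
  exact h t ht y hy x hx

/-- The condition on the data implies the absence of interaction, by comparison of the solution
with those for the positive and the negative part of the data. -/
theorem DataNonInteracting.nonInteracting {f : L1 N} {u : ℝ → L1 N} (hu : IsSolution K f u)
    (h : DataNonInteracting K f) : NonInteracting K u := by
  obtain ⟨Up, Um, hp, hm, hsep⟩ := h
  intro t ht x hx y hy
  have hfp : f ≤ Lp.posPart f := by
    refine coeFn_le_of_ae ?_
    filter_upwards [Lp.coeFn_posPart f] with x hx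
    rw [hx]
    exact le_max_left _ _
  have hfm : -f ≤ Lp.negPart f := by
    refine coeFn_le_of_ae ?_
    filter_upwards [Lp.coeFn_negPart_eq_max f, Lp.coeFn_neg f] with x hx hx2
    rw [hx, hx2]
    exact le_max_left _ _
  have hfp0 : 0 ≤ Lp.posPart f := by
    refine (Lp.coeFn_nonneg _).1 ?_
    filter_upwards [Lp.coeFn_posPart f] with x hx
    rw [hx]
    exact le_max_right _ _
  have hfm0 : 0 ≤ Lp.negPart f := by
    refine (Lp.coeFn_nonneg _).1 ?_
    filter_upwards [Lp.coeFn_negPart_eq_max f] with x hx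
    rw [hx]
    exact le_max_right _ _
  refine hsep x (Set.mem_biUnion ht ?_) y (Set.mem_biUnion ht ?_)
  · refine distSupport_mono (L1.integrable_coeFn _) ?_ hx
    filter_upwards [ae_le_of_le (temperature_mono (hu.le_of_le hp hfp t ht.le)),
      (Lp.coeFn_nonneg _).2 (temperature_nonneg (hp.nonneg hfp0 t ht.le))] with x h1 h2
    exact ⟨le_max_right _ _, max_le h1 h2⟩
  · refine distSupport_mono (L1.integrable_coeFn _) ?_ hy
    have h3 := temperature_mono (hu.neg.le_of_le hm hfm t ht.le)
    rw [temperature_neg] at h3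
    filter_upwards [ae_le_of_le h3, Lp.coeFn_neg (temperature (u t)),
      (Lp.coeFn_nonneg _).2 (temperature_nonneg (hm.nonneg hfm0 t ht.le))] with x h1 h4 h2
    rw [h4] at h1
    exact ⟨le_max_right _ _, max_le h1 h2⟩

/-! ### Retention of the phases -/

/-- Restriction of `L¹` functions to a set. -/
noncomputable abbrev restrictL1 (B : Set (Space N)) :
    L1 N →L[ℝ] Lp ℝ 1 ((volume : Measure (Space N)).restrict B) :=
  LpToLpRestrictCLM (Space N) ℝ ℝ volume 1 B

theorem restrictL1_le_iff {B : Set (Space N)} (hB : MeasurableSet B) {v w : L1 N} :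
    restrictL1 B v ≤ restrictL1 B w ↔ ∀ᵐ x, x ∈ B → v x ≤ w x := by
  rw [← Lp.coeFn_le, ← ae_restrict_iff' hB]
  constructor
  · intro h
    filter_upwards [h, LpToLpRestrictCLM_coeFn ℝ B v, LpToLpRestrictCLM_coeFn ℝ B w]
      with x h1 h2 h3
    rwa [h2, h3] at h1
  · intro h
    filter_upwards [h, LpToLpRestrictCLM_coeFn ℝ B v, LpToLpRestrictCLM_coeFn ℝ B w]
      with x h1 h2 h3
    rwa [h2, h3]

theorem smul_indicator_le_restrictL1_iff {B : Set (Space N)} (hB : MeasurableSet B)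
    (hB' : volume B ≠ ⊤) (c : ℝ) {v : L1 N} :
    c • restrictL1 B (indicatorConstLp 1 hB hB' 1) ≤ restrictL1 B v ↔
      ∀ᵐ x, x ∈ B → c ≤ v x := by
  rw [← map_smul, restrictL1_le_iff hB]
  have h : ∀ᵐ x, x ∈ B → (c • indicatorConstLp 1 hB hB' (1 : ℝ)) x = c := by
    filter_upwards [Lp.coeFn_smul c (indicatorConstLp 1 hB hB' (1 : ℝ)),
      indicatorConstLp_coeFn (p := 1) (hs := hB) (hμs := hB') (c := (1 : ℝ))] with x h1 h2 hx
    rw [h1, Pi.smul_apply, h2, Set.indicator_of_mem hx, smul_eq_mul, mul_one]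
  constructor <;> intro h1
  · filter_upwards [h, h1] with x h2 h3 hx
    rw [← h2 hx]
    exact h3 hx
  · filter_upwards [h, h1] with x h2 h3 hx
    rw [h2 hx]
    exact h3 hx

theorem Kernel.exists_neg_le_conv (K : Kernel N) (M : ℝ) :
    ∃ C, 0 ≤ C ∧ ∀ v : L1 N, ‖v‖ ≤ M → ∀ᵐ x, -C ≤ K.conv v x := by
  obtain ⟨B, hB0, hB⟩ := K.exists_bound
  refine ⟨B * |M|, by positivity, fun v hv => ?_⟩
  filter_upwards [K.coeFn_conv v] with x hx
  rw [hx, K.avg_eq]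
  have h1 : |∫ y, K.J (x - y) * v y| ≤ ∫ y, B * ‖v y‖ := by
    rw [← Real.norm_eq_abs]
    refine norm_integral_le_of_norm_le ((L1.integrable_coeFn v).norm.const_mul B)
      (Eventually.of_forall fun y => ?_)
    rw [norm_mul, Real.norm_of_nonneg (K.nonneg _)]
    gcongr
    exact hB _
  rw [integral_const_mul, ← L1.norm_eq_integral_norm] at h1
  have h2 : B * ‖v‖ ≤ B * |M| := by
    gcongr
    exact hv.trans (le_abs_self M)
  linarith [(abs_le.1 (h1.trans h2)).1]

namespace IsSolution

variable {f : L1 N} {u : ℝ → L1 N}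

/-- If `J ∗ Γ(u) + (u - Γ(u)) ≥ c` on `B` during a time interval, then `e^t (u(t) - c)`
increases there on `B`. -/
theorem exp_smul_sub_le (hu : IsSolution K f u) {B : Set (Space N)} (hB : MeasurableSet B)
    (hB' : volume B ≠ ⊤) (c : ℝ) {s t : ℝ} (hs : 0 ≤ s) (hst : s ≤ t)
    (h : ∀ r ∈ Set.Ioo s t, ∀ᵐ x, x ∈ B → c ≤ (u r + K.field (u r)) x) :
    Real.exp s • (restrictL1 B (u s) - c • restrictL1 B (indicatorConstLp 1 hB hB' 1)) ≤
      Real.exp t • (restrictL1 B (u t) - c • restrictL1 B (indicatorConstLp 1 hB hB' 1)) := by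
  set e := restrictL1 B (indicatorConstLp 1 hB hB' 1)
  set z : ℝ → Lp ℝ 1 ((volume : Measure (Space N)).restrict B) :=
    fun r => Real.exp r • (restrictL1 B (u r) - c • e)
  set z' : ℝ → Lp ℝ 1 ((volume : Measure (Space N)).restrict B) :=
    fun r => Real.exp r • (restrictL1 B (u r + K.field (u r)) - c • e)
  have hsub : Set.uIcc s t ⊆ Set.Ici 0 := by
    rw [Set.uIcc_of_le hst]
    exact fun r hr => hs.trans hr.1
  have hcont : ContinuousOn z (Set.uIcc s t) :=
    Real.continuous_exp.continuousOn.smul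
      (((restrictL1 B).continuous.comp_continuousOn (hu.continuousOn.mono hsub)).sub
        continuousOn_const)
  have hcont' : ContinuousOn z' (Set.uIcc s t) := by
    have h1 : ContinuousOn u (Set.uIcc s t) := hu.continuousOn.mono hsub
    exact Real.continuous_exp.continuousOn.smul
      (((restrictL1 B).continuous.comp_continuousOn
        (h1.add (K.field_lipschitz.continuous.comp_continuousOn h1))).sub continuousOn_const)
  have hderiv : ∀ r ∈ Set.Ioo (min s t) (max s t), HasDerivWithinAt z (z' r) (Set.Ioi r) r := by
    intro r hr
    rw [min_eq_left hst, max_eq_right hst] at hr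
    have h1 := (hu.hasDerivWithinAt r (hs.trans hr.1.le)).mono Set.Ioi_subset_Ici_self
    have h2 : HasDerivWithinAt (fun r => restrictL1 B (u r) - c • e)
        (restrictL1 B (K.field (u r))) (Set.Ioi r) r :=
      ((restrictL1 B).hasFDerivAt.comp_hasDerivWithinAt r h1).sub_const _
    have h3 := (Real.hasDerivAt_exp r).hasDerivWithinAt (s := Set.Ioi r) |>.smul h2
    refine h3.congr_deriv ?_
    change _ = Real.exp r • (restrictL1 B (u r + K.field (u r)) - c • e)
    rw [map_add]
    module
  have hint := intervalIntegral.integral_eq_sub_of_hasDeriv_right hcont hderiv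
    hcont'.intervalIntegrable
  rw [← sub_nonneg]
  change 0 ≤ z t - z s
  rw [← hint, intervalIntegral.integral_of_le hst, integral_Ioc_eq_integral_Ioo]
  refine integral_nonneg_of_ae ((ae_restrict_iff' measurableSet_Ioo).2
    (Eventually.of_forall fun r hr => ?_))
  exact smul_nonneg (Real.exp_pos r).le
    (sub_nonneg.2 ((smul_indicator_le_restrictL1_iff hB hB' c).2 (h r hr)))

/-- Without interaction, the excess over the phase change value decays at most exponentially. For a
short time it stays positive since `J ∗ Γ(u)` is bounded; as long as it is positive,
`J ∗ Γ(u) ≥ 0` and hence `(u - 1)' ≥ -(u - 1)`. -/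
theorem one_add_le_of_nonInteracting (hN : 1 ≤ N) (hu : IsSolution K f u)
    (h : NonInteracting K u) {s t δ : ℝ} (hs : 0 < s) (hst : s ≤ t) (hδ : 0 < δ) :
    ∀ᵐ x, 1 + δ ≤ u s x → 1 + δ * Real.exp (s - t) ≤ u t x := by
  set B := {x | 1 + δ ≤ u s x} with hBdef
  have hB : MeasurableSet B :=
    measurableSet_le measurable_const (Lp.stronglyMeasurable (u s)).measurable
  have hB' : volume B ≠ ⊤ :=
    ((L1.integrable_coeFn (u s)).measure_ge_lt_top (by linarith)).ne
  obtain ⟨C, hC0, hC⟩ := K.exists_neg_le_conv ‖f‖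
  set e := restrictL1 B (indicatorConstLp 1 hB hB' 1) with he
  have hbound : ∀ r, (1 + δ * Real.exp (s - r)) • e ≤ restrictL1 B (u r) ↔
      ∀ᵐ x, x ∈ B → 1 + δ * Real.exp (s - r) ≤ u r x := fun r =>
    smul_indicator_le_restrictL1_iff hB hB' _
  have hadd : ∀ r, ∀ᵐ x, (u r + K.field (u r)) x =
      K.conv (temperature (u r)) x + (u r x - Gam (u r x)) := by
    intro r
    rw [K.add_field_eq]
    filter_upwards [Lp.coeFn_add (K.conv (temperature (u r))) (u r - temperature (u r)),
      Lp.coeFn_sub (u r) (temperature (u r)), coeFn_temperature (u r)] with x h1 h2 h3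
    rw [h1, Pi.add_apply, h2, Pi.sub_apply, h3]
  have hmain : Set.Icc s t ⊆ {r | (1 + δ * Real.exp (s - r)) • e ≤ restrictL1 B (u r)} := by
    refine IsClosed.Icc_subset_of_forall_exists_gt ?_ ?_ ?_
    · have hc1 : ContinuousOn (fun r => restrictL1 B (u r)) (Set.Icc s t) :=
        (restrictL1 B).continuous.comp_continuousOn
          (hu.continuousOn.mono fun r hr => hs.le.trans hr.1)
      have hc2 : ContinuousOn (fun r => (1 + δ * Real.exp (s - r)) • e) (Set.Icc s t) := by
        fun_prop
      rw [Set.inter_comm]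
      exact isClosed_Icc.isClosed_le hc2 hc1
    · rw [Set.mem_ofPred_eq, hbound s]
      refine Eventually.of_forall fun x hx => ?_
      rw [sub_self, Real.exp_zero, mul_one]
      exact hx
    · rintro τ ⟨hτ, hτs, hτt⟩ y hy
      have hy : τ < y := hy
      rw [Set.mem_ofPred_eq] at hτ
      set δ' := δ * Real.exp (s - τ) with hδ'
      have hδ'0 : 0 < δ' := by positivity
      have hτ0 : 0 ≤ τ := hs.le.trans hτs
      -- a short time during which the crude bound keeps `u` above `1`
      have hev : ∀ᶠ r in 𝓝 τ, 1 < -(C + 1) + Real.exp (τ - r) * (1 + δ' + (C + 1)) := by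
        have hc : Continuous fun r => -(C + 1) + Real.exp (τ - r) * (1 + δ' + (C + 1)) := by
          fun_prop
        refine hc.continuousAt.eventually_const_lt ?_
        change 1 < -(C + 1) + Real.exp (τ - τ) * (1 + δ' + (C + 1))
        rw [sub_self, Real.exp_zero]
        linarith
      obtain ⟨η, hη, hηball⟩ := Metric.eventually_nhds_iff.1 hev
      set σ := min y (τ + η / 2) with hσ
      have hτσ : τ < σ := lt_min hy (by linarith)
      have hση : σ ≤ τ + η / 2 := min_le_right _ _
      have hgt : ∀ r, τ ≤ r → r ≤ σ → ∀ᵐ x, x ∈ B → 1 < u r x := by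
        intro r hr1 hr2
        have h1 := hu.exp_smul_sub_le hB hB' (-(C + 1)) hτ0 hr1 fun q hq => by
          filter_upwards [hadd q, hC _ (hu.norm_temperature_le q (hτ0.trans hq.1.le))]
            with x h1 h2 _
          rw [h1]
          linarith [neg_one_le_sub_Gam (u q x)]
        have h2 : (-(C + 1) + Real.exp (τ - r) * (1 + δ' + (C + 1))) • e ≤
            restrictL1 B (u r) := by
          have h3 : (1 + δ' + (C + 1)) • e ≤ restrictL1 B (u τ) - (-(C + 1)) • e := by
            rw [le_sub_iff_add_le, ← add_smul]
            convert hτ using 2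
            ring
          have h4 := (smul_le_smul_of_nonneg_left h3 (Real.exp_pos τ).le).trans h1
          have h5 := smul_le_smul_of_nonneg_left h4 (Real.exp_pos (-r)).le
          rw [smul_smul, smul_smul, smul_smul, ← Real.exp_add, ← Real.exp_add, neg_add_cancel,
            Real.exp_zero, one_smul, le_sub_iff_add_le, ← add_smul] at h5
          refine le_of_eq_of_le (congrArg (· • e) ?_) h5
          rw [neg_add_eq_sub r τ]
          ring
        have h6 := (smul_indicator_le_restrictL1_iff hB hB' _).1 h2
        have h7 := hηball (y := r) (by
          rw [Real.dist_eq, abs_of_nonneg (by linarith)]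
          linarith)
        filter_upwards [h6] with x hx hxB
        exact h7.trans_le (hx hxB)
      have h1 := hu.exp_smul_sub_le hB hB' 1 hτ0 hτσ.le fun q hq => by
        filter_upwards [hadd q, hgt q hq.1.le hq.2.le, coeFn_temperature (u q),
          K.conv_nonneg_of_separatedBy hN (h q (hτ0.trans_lt hq.1))] with x h1 h2 h3 h4 hxB
        have h5 := h2 hxB
        rw [h3] at h4
        have h6 := h4 (Gam_pos h5)
        rw [h1, Gam_of_one_le h5.le]
        linarith
      refine ⟨σ, ?_, hτσ, min_le_left _ _⟩
      rw [Set.mem_ofPred_eq]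
      have h3 : δ' • e ≤ restrictL1 B (u τ) - (1 : ℝ) • e := by
        rw [le_sub_iff_add_le, ← add_smul, add_comm]
        exact hτ
      have h4 := (smul_le_smul_of_nonneg_left h3 (Real.exp_pos τ).le).trans h1
      have h5 := smul_le_smul_of_nonneg_left h4 (Real.exp_pos (-σ)).le
      rw [smul_smul, smul_smul, smul_smul, ← Real.exp_add, ← Real.exp_add, neg_add_cancel,
        Real.exp_zero, one_smul, le_sub_iff_add_le, ← add_smul] at h5
      refine le_of_eq_of_le (congrArg (· • e) ?_) h5
      have h6 : s - σ = -σ + τ + (s - τ) := by ring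
      rw [hδ', h6, Real.exp_add (-σ + τ)]
      ring
  exact (hbound t).1 (hmain ⟨hst, le_rfl⟩)

/-- Retention: without interaction, points in the positive phase remain there. -/
theorem temperature_pos_of_nonInteracting (hN : 1 ≤ N) (hu : IsSolution K f u)
    (h : NonInteracting K u) {s t : ℝ} (hs : 0 < s) (hst : s ≤ t) :
    ∀ᵐ x, 0 < temperature (u s) x → 0 < temperature (u t) x := by
  have h1 : ∀ᵐ x, ∀ n : ℕ, 1 + 1 / ((n : ℝ) + 1) ≤ u s x →
      1 + 1 / ((n : ℝ) + 1) * Real.exp (s - t) ≤ u t x :=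
    ae_all_iff.2 fun n => hu.one_add_le_of_nonInteracting hN h hs hst (by positivity)
  filter_upwards [h1, coeFn_temperature (u s), coeFn_temperature (u t)] with x h2 h3 h4 hx
  rw [h3] at hx
  rw [h4]
  have hus := one_lt_of_Gam_pos hx
  obtain ⟨n, hn⟩ := exists_nat_one_div_lt (sub_pos.2 hus)
  have h5 := h2 n (by linarith)
  refine Gam_pos (lt_of_lt_of_le ?_ h5)
  have : 0 < 1 / ((n : ℝ) + 1) * Real.exp (s - t) := by positivity
  linarith

/-- By retention, the time integral of the temperature is positive in the positive phase only. -/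
theorem one_lt_of_baiocchi_pos (hN : 1 ≤ N) (hu : IsSolution K f u)
    (h : NonInteracting K u) {t : ℝ} (ht : 0 ≤ t) :
    ∀ᵐ x, 0 < baiocchi u t x → 1 < u t x := by
  set Z := {x | temperature (u t) x ≤ 0} with hZ
  have hZm : MeasurableSet Z :=
    measurableSet_le (Lp.stronglyMeasurable _).measurable measurable_const
  have hle : restrictL1 Z (baiocchi u t) ≤ restrictL1 Z 0 := by
    rw [baiocchi, ← (restrictL1 Z).intervalIntegral_comp_comm
      (hu.intervalIntegrable_temperature le_rfl ht), map_zero, ← neg_nonneg,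
      ← intervalIntegral.integral_neg, intervalIntegral.integral_of_le ht]
    refine integral_nonneg_of_ae ((ae_restrict_iff' measurableSet_Ioc).2
      (Eventually.of_forall fun r hr => ?_))
    have h1 : restrictL1 Z (temperature (u r)) ≤ restrictL1 Z 0 := by
      rw [restrictL1_le_iff hZm]
      filter_upwards [hu.temperature_pos_of_nonInteracting hN h hr.1 hr.2,
        Lp.coeFn_zero ℝ 1 (volume : Measure (Space N))] with x h1 h2 hx
      rw [h2]
      by_contra! h3
      exact absurd (h1 h3) (not_lt.2 hx)
    rw [map_zero] at h1
    exact neg_nonneg.2 h1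
  filter_upwards [(restrictL1_le_iff hZm).1 hle, coeFn_temperature (u t),
    Lp.coeFn_zero ℝ 1 (volume : Measure (Space N))] with x h1 h2 h3 hx
  refine one_lt_of_Gam_pos ?_
  rw [← h2]
  by_contra! h4
  have h5 := h1 h4
  rw [h3] at h5
  exact absurd hx (not_lt.2 h5)

/-- Without interaction, the time integral of the temperature solves the biobstacle problem with
data `f - Γ(u(t))`, and the projection of these data is the truncation `u(t) - Γ(u(t))`. -/
theorem isBOPSolution_baiocchi (hN : 1 ≤ N) (hu : IsSolution K f u)
    (h : NonInteracting K u) {t : ℝ} (ht : 0 ≤ t) :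
    IsBOPSolution K (f - temperature (u t)) (baiocchi u t) ∧
      K.mesa (f - temperature (u t)) (baiocchi u t) = u t - temperature (u t) := by
  have hmesa : K.mesa (f - temperature (u t)) (baiocchi u t) = u t - temperature (u t) := by
    nth_rw 2 [hu.eq_mesa t ht]
    rw [Kernel.mesa, Kernel.mesa]
    abel
  refine ⟨?_, hmesa⟩
  have hneg : baiocchi (fun t => -u t) t = -baiocchi u t := by
    simp only [baiocchi, temperature_neg, intervalIntegral.integral_neg]
  have h2 := hu.neg.one_lt_of_baiocchi_pos hN h.neg ht
  rw [hneg] at h2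
  rw [IsBOPSolution, hmesa]
  filter_upwards [hu.one_lt_of_baiocchi_pos hN h ht, h2, Lp.coeFn_neg (baiocchi u t),
    Lp.coeFn_neg (u t), Lp.coeFn_sub (u t) (temperature (u t)), coeFn_temperature (u t)]
    with x h3 h4 h5 h6 h7 h8
  rw [h5, h6, Pi.neg_apply, Pi.neg_apply] at h4
  rw [h7, Pi.sub_apply, h8]
  refine ⟨fun hw => ?_, fun _ => ⟨neg_one_le_sub_Gam _, sub_Gam_le_one _⟩⟩
  rcases lt_or_gt_of_ne hw with hw | hw
  · rw [Real.sign_of_neg hw, Gam_of_le_neg_one (by linarith [h4 (by linarith)])]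
    ring
  · rw [Real.sign_of_pos hw, Gam_of_one_le (h3 hw).le]
    ring

/-- Without interaction, the distance of the solution to the projection of the data is controlled by
the temperature. -/
theorem tendsto_of_nonInteracting (hN : 1 ≤ N) (hu : IsSolution K f u)
    (h : NonInteracting K u) {P : L1 N → L1 N} (hP : LipschitzWith 1 P)
    (hPmesa : ∀ f w : L1 N, IsBOPSolution K f w → P f = K.mesa f w) :
    Tendsto u atTop (𝓝 (P f)) := by
  have hT := hu.tendsto_temperature hN
  have h1 : Tendsto (fun t => P (f - temperature (u t)) + temperature (u t)) atTop
      (𝓝 (P (f - 0) + 0)) :=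
    ((hP.continuous.tendsto _).comp (tendsto_const_nhds.sub hT)).add hT
  rw [sub_zero, add_zero] at h1
  refine h1.congr' ?_
  filter_upwards [eventually_ge_atTop 0] with t ht
  obtain ⟨h2, h3⟩ := hu.isBOPSolution_baiocchi hN h ht
  rw [hPmesa _ _ h2, h3]
  abel

end IsSolution

end NonlocalStefan

theorem mainTheorem2 (N : ℕ) (hN : 1 ≤ N) (K : NonlocalStefan.Kernel N) :
    -- the initial value problem has a solution, unique for nonnegative times
    (∀ f : NonlocalStefan.L1 N, ∃ u, NonlocalStefan.IsSolution K f u ∧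
      ∀ u', NonlocalStefan.IsSolution K f u' → Set.EqOn u' u (Set.Ici 0)) ∧
    -- the biobstacle problem is uniquely solvable on a dense class (on all data if `N ≥ 3`)
    Dense {f : NonlocalStefan.L1 N | NonlocalStefan.IsDominated f} ∧
    (∀ f : NonlocalStefan.L1 N, 3 ≤ N ∨ NonlocalStefan.IsDominated f →
      ∃! w : NonlocalStefan.L1 N, NonlocalStefan.IsBOPSolution K f w) ∧
    ∃ P : NonlocalStefan.L1 N → NonlocalStefan.L1 N,
      -- `P` is a continuous (even contractive) operator on all of `L¹`
      LipschitzWith 1 P ∧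
      -- `P` is the projection given by the biobstacle problem, whenever that is solvable
      (∀ f w : NonlocalStefan.L1 N, NonlocalStefan.IsBOPSolution K f w → P f = K.mesa f w) ∧
      -- `P` is the only continuous extension of the projection from the dense class
      (∀ Q : NonlocalStefan.L1 N → NonlocalStefan.L1 N, Continuous Q →
        (∀ f w : NonlocalStefan.L1 N, NonlocalStefan.IsDominated f →
          NonlocalStefan.IsBOPSolution K f w → Q f = K.mesa f w) → Q = P) ∧
      -- convergence to `P f` for integrable data without interaction of the two temperatures
      (∀ (f : NonlocalStefan.L1 N) (u : ℝ → NonlocalStefan.L1 N),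
        NonlocalStefan.IsSolution K f u →
        NonlocalStefan.NonInteracting K u ∨ NonlocalStefan.DataNonInteracting K f →
        Filter.Tendsto u Filter.atTop (nhds (P f))) := by
  refine ⟨fun f => ?_, NonlocalStefan.dense_isDominated hN K, fun f hf => ?_, ?_⟩
  · obtain ⟨u, hu⟩ := K.exists_isSolution f
    exact ⟨u, hu, fun u' hu' => hu'.eqOn hu⟩
  · obtain ⟨w, hw⟩ : ∃ w, NonlocalStefan.IsBOPSolution K f w := by
      rcases hf with h3 | hf
      · exact NonlocalStefan.exists_isBOPSolution_of_three_le K h3 f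
      · exact hf.exists_isBOPSolution K hN
    exact ⟨w, hw, fun w' hw' => hw'.unique hN hw⟩
  · obtain ⟨P, hP, hPmesa⟩ := NonlocalStefan.exists_projection hN K
    refine ⟨P, hP, hPmesa, fun Q hQ hQmesa => ?_, fun f u hu h => ?_⟩
    · refine hQ.ext_on (NonlocalStefan.dense_isDominated hN K) hP.continuous fun f hf => ?_
      obtain ⟨w, hw⟩ := NonlocalStefan.IsDominated.exists_isBOPSolution K hN hf
      rw [hQmesa f w hf hw, hPmesa f w hw]
    · exact hu.tendsto_of_nonInteracting hN (h.elim id fun h => h.nonInteracting hu) hP hPmesa
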